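/- Let $k$ be an algebraically closed field of characteristic $0$, and let $H$ be a Hopf algebra over $k$ whose underlying algebra carries an $\mathbb{N}$-grading $H=\bigoplus_{i\ge 0}H(i)$ (as an algebra; no compatibility with the coalgebra structure is assumed) which is connected, $H(0)=k$, and locally finite, $\dim_k H(i)<\infty$ for all $i$. Let $H_H(t)=\sum_{i\ge 0}\dim_k H(i)\,t^i$ be its Hilbert series. Then there is a sequence $(n_i)_{i\ge 1}$ of non-negative integers such that the following hold. 1. $$H_H(t)=\frac{1}{\prod_{i=1}^{\infty}(1-t^i)^{n_i}},$$ and $(n_i)_{i\ge1}$ is the only sequence of non-negative integers with this property. 2. If $H$ is generated as an algebra by $H(1)$, then $H$ is isomorphic as an algebra to the universal enveloping algebra $U(\mathfrak g)$ of a graded Lie algebra $\mathfrak g=\bigoplus_{i\ge 1}\mathfrak g_i$ that is generated as a Lie algebra by $\mathfrak g_1$ and satisfies $\dim_k\mathfrak g_i=n_i$ for all $i\ge 1$. 3. If $H$ is generated as an algebra by $H(1)$ and $H\neq k$, then $\{j\ge 1: n_j\neq 0\}=[1,\ell)\cap\mathbb{N}$ for some $\ell\in[2,\infty]$. 4. If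 $H_H(t)=\frac{1}{(1-t)^d}$ for some integer $d\ge 0$, then $H$ is commutative, and $H\cong k[x_1,\dots,x_d]$ as algebras. 5. $\operatorname{GKdim}H<\infty$ if and only if $\sum_{i=1}^{\infty}n_i<\infty$, and in this case $\operatorname{GKdim}H=\sum_{i=1}^{\infty}n_i$. Here $\operatorname{GKdim}H=\sup_V\limsup_{n\to\infty}\log\big(\dim_k\sum_{i=0}^{n}V^i\big)/\log n$ is the Gelfand–Kirillov dimension, with $V$ ranging over the finite-dimensional subspaces of $H$. -/

import Mathlib

universe u v

namespace GradedHopf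

noncomputable section

open Filter PowerSeries
open scoped PowerSeries.WithPiTopology ENNReal

/-- An `ℕ`-graded algebra `A = ⨁ A(i)` is connected if `A(0) = k`, the image of the base field. -/
def IsConnected {k : Type u} {A : Type v} [Field k] [Ring A] [Algebra k A]
    (𝒜 : ℕ → Submodule k A) : Prop :=
  𝒜 0 = 1

/-- A grading is locally finite if all its components are finite-dimensional. -/
def IsLocallyFinite {k : Type u} {A : Type v} [Field k] [AddCommGroup A] [Module k A]
    (𝒜 : ℕ → Submodule k A) : Prop :=
  ∀ i, Module.Finite k (𝒜 i)

/-- The graded algebra is generated, as an algebra, by its component of degree `1`. -/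
def IsGeneratedInDegreeOne {k : Type u} {A : Type v} [Field k] [Ring A] [Algebra k A]
    (𝒜 : ℕ → Submodule k A) : Prop :=
  Algebra.adjoin k (𝒜 1 : Set A) = ⊤

/-- The Hilbert series `∑ dim A(i) t ^ i` (meant for locally finite gradings). -/
def hilbertSeries {k : Type u} {A : Type v} [Field k] [AddCommGroup A] [Module k A]
    (𝒜 : ℕ → Submodule k A) : ℤ⟦X⟧ :=
  PowerSeries.mk fun i => (Module.finrank k (𝒜 i) : ℤ)

/-- `h = 1 / ∏_{i ≥ 1} (1 - t ^ i) ^ (n i)` in `ℤ⟦t⟧`, where the infinite product converges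
coefficientwise (`ℤ` is discrete). -/
def IsInverseProduct (h : ℤ⟦X⟧) (n : ℕ+ → ℕ) : Prop :=
  ∃ P : ℤ⟦X⟧, HasProd (fun i : ℕ+ => (1 - (X : ℤ⟦X⟧) ^ (i : ℕ)) ^ n i) P ∧ h * P = 1

/-- The Gelfand–Kirillov dimension: the supremum over all finite-dimensional subspaces `V` of
`limsup log (dim (k + V + ⋯ + V ^ n)) / log n`; note `k + V + ⋯ + V ^ n = (k + V) ^ n`. -/
def GKdim (k : Type u) (A : Type v) [Field k] [Ring A] [Algebra k A] : EReal :=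
  ⨆ V : {V : Submodule k A // V.FG},
    limsup (fun n : ℕ =>
      ((Real.log (Module.finrank k ↥((1 ⊔ V.1) ^ n)) / Real.log n : ℝ) : EReal)) atTop

end

end GradedHopf

/-! The argument is a Poincaré–Birkhoff–Witt theorem for `H`, obtained from a filtration and a
suitably twisted coproduct.

Connectedness makes the projection to degree zero a character `χ`. The counit of `H` may be a
different character, so the coproduct is twisted by `χ` into an algebra map `D` with `χ` as
two-sided counit (`exists_comul_with_counit`). Coassociativity of `D` is not needed. For `a` in `ker
χ`, `D a` equals `a ⊗ 1 + 1 ⊗ a` up to `ker χ ⊗ ker χ`. Hence, for the filtration by the powers `F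
n` of `ker χ`, elements of `ker χ` are primitive to leading order, and so are their iterated
commutators. Moreover `F n` is a homogeneous subspace living in degrees at least `n`, so the
filtration is separated in each degree.

Take iterated commutators ("Lie words") of homogeneous elements, bigraded by length and degree, and
choose homogeneous ones that form a basis modulo the next step of the filtration
(`exists_lieGenerators`). Their ordered monomials form a basis of `H`. They span because a
commutator of generators is, to leading order, a combination of generators, so words can be sorted
(`word_mem_span_orderedMonomial`). They are independent because `D` splits a monomial into
complementary submonomials with multiplicities that are nonzero in characteristic zero
(`linearIndepOn_orderedMonomial`).

With `n i` the number of generators of degree `i`, the Hilbert series counts multisets of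
generators, which gives the product; the exponents are recovered coefficient by coefficient. If `H`
is generated in degree one, length equals degree, error terms vanish for degree reasons, and the
generators span a Lie algebra whose enveloping algebra is `H`; a vanishing layer of Lie words then
kills the next one. If the series is `(1 - t) ^ (-d)`, all generators have degree one and no
generator of length two is available for their commutators. Finally, counting ordered monomials
bounds the Gelfand–Kirillov dimension from both sides by the number of generators. -/

namespace GradedHopf

/-! ### Sorting words modulo a filtration -/

section Words

variable {k : Type*} {A : Type*} {S : Type*} [Field k] [Ring A] [Algebra k A]

/-- The linear combinations of words of length `< m` and degree `n` in the letters `x s`,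
up to elements of `F (n + 1)`. -/
def shorterWords (x : S → A) (d : S → ℕ) (F : ℕ → Submodule k A) (m n : ℕ) : Submodule k A :=
  Submodule.span k {y | ∃ l : List S, l.length < m ∧ (l.map d).sum = n ∧ (l.map x).prod = y} ⊔
    F (n + 1)

lemma word_mem_shorterWords (x : S → A) (d : S → ℕ) (F : ℕ → Submodule k A) {m n : ℕ} (l : List S)
    (hl : l.length < m) (hd : (l.map d).sum = n) :
    (l.map x).prod ∈ shorterWords x d F m n :=
  Submodule.mem_sup_left (Submodule.subset_span ⟨l, hl, hd, rfl⟩)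

lemma mul_mem_shorterWords {x : S → A} {d : S → ℕ} {F : ℕ → Submodule k A}
    (hl : ∀ s n, ∀ y ∈ F n, x s * y ∈ F (d s + n)) (s : S) {m n : ℕ} {y : A}
    (hy : y ∈ shorterWords x d F m n) :
    x s * y ∈ shorterWords x d F (m + 1) (d s + n) := by
  obtain ⟨a, ha, b, hb, rfl⟩ := Submodule.mem_sup.1 hy
  rw [mul_add]
  refine add_mem ?_ (Submodule.mem_sup_right (hl s _ b hb))
  clear hy
  induction ha using Submodule.span_induction with
  | mem y hy =>
    obtain ⟨l, h1, h2, rfl⟩ := hy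
    exact word_mem_shorterWords x d F (s :: l) (by simpa using h1) (by simp [h2])
  | zero => simp
  | add y z _ _ h1 h2 => rw [mul_add]; exact add_mem h1 h2
  | smul c y _ h => rw [mul_smul_comm]; exact Submodule.smul_mem _ _ h

lemma mul_word_mem {x : S → A} {d : S → ℕ} {F : ℕ → Submodule k A}
    (hr : ∀ s n, ∀ y ∈ F n, y * x s ∈ F (n + d s)) (l : List S) {n : ℕ} {y : A} (hy : y ∈ F n) :
    y * (l.map x).prod ∈ F (n + (l.map d).sum) := by
  induction l generalizing n y with
  | nil => simpa using hy
  | cons s l ih =>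
    have := ih (hr s n y hy)
    simpa [mul_assoc, add_assoc] using this

/-- Permuting a word changes it by a combination of shorter words. -/
lemma word_sub_word_mem_of_perm {x : S → A} {d : S → ℕ} {F : ℕ → Submodule k A}
    (hl : ∀ s n, ∀ y ∈ F n, x s * y ∈ F (d s + n))
    (hr : ∀ s n, ∀ y ∈ F n, y * x s ∈ F (n + d s))
    (hc : ∀ s t, x s * x t - x t * x s ∈
      Submodule.span k (x '' {u | d u = d s + d t}) ⊔ F (d s + d t + 1))
    {l l' : List S} (h : l.Perm l') :
    (l.map x).prod - (l'.map x).prod ∈ shorterWords x d F l.length (l.map d).sum := by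
  induction h with
  | nil => simp
  | cons a _ ih =>
    have := mul_mem_shorterWords hl a ih
    simpa [mul_sub] using this
  | swap a b l =>
    -- The commutator of two adjacent letters is a combination of single letters, so this part of
    -- the difference has one letter fewer; the error lies deeper in `F`.
    have key : ∀ z ∈ Submodule.span k (x '' {u | d u = d b + d a}) ⊔ F (d b + d a + 1),
        z * (l.map x).prod ∈ shorterWords x d F (l.length + 2) (d b + (d a + (l.map d).sum)) := by
      intro z hz
      obtain ⟨p, hp, q, hq, rfl⟩ := Submodule.mem_sup.1 hz
      rw [add_mul]
      refine add_mem ?_ (Submodule.mem_sup_right ?_)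
      · clear hz
        induction hp using Submodule.span_induction with
        | mem y hy =>
          obtain ⟨u, hu, rfl⟩ := hy
          refine word_mem_shorterWords x d F (u :: l) (by simp) ?_
          have : d u = d b + d a := hu
          simp [this, add_assoc]
        | zero => simp
        | add y z _ _ h1 h2 => rw [add_mul]; exact add_mem h1 h2
        | smul c y _ h => rw [smul_mul_assoc]; exact Submodule.smul_mem _ _ h
      · have := mul_word_mem hr l hq
        convert this using 2
        ring
    have := key _ (hc b a)
    simpa [sub_mul, mul_assoc] using this
  | trans h1 h2 ih1 ih2 =>
    rw [← h1.length_eq, ← (h1.map d).sum_eq] at ih2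
    simpa using add_mem ih1 ih2

end Words

section OrderedMonomial

variable {k : Type*} {A : Type*} {S : Type*} [Field k] [Ring A] [Algebra k A] [LinearOrder S]

/-- The product of the elements `x s`, for `s` in the multiset `α`, in increasing order. -/
def orderedMonomial (x : S → A) (α : Multiset S) : A := ((α.sort (· ≤ ·)).map x).prod

@[simp] lemma orderedMonomial_zero (x : S → A) : orderedMonomial x 0 = 1 := by
  simp [orderedMonomial]

@[simp] lemma orderedMonomial_singleton (x : S → A) (s : S) : orderedMonomial x {s} = x s := by
  simp [orderedMonomial]

lemma orderedMonomial_cons (x : S → A) {s : S} {α : Multiset S} (h : ∀ b ∈ α, s ≤ b) :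
    orderedMonomial x (s ::ₘ α) = x s * orderedMonomial x α := by
  simp [orderedMonomial, Multiset.sort_cons s α _ h]

/-- Peels off a smallest letter, so that `orderedMonomial_cons` applies at each step. -/
lemma orderedMonomial_induction {P : Multiset S → Prop} (zero : P 0)
    (cons : ∀ s α, (∀ b ∈ α, s ≤ b) → P α → P (s ::ₘ α)) (α : Multiset S) : P α := by
  have key : ∀ l : List S, l.Pairwise (· ≤ ·) → P (l : Multiset S) := by
    intro l
    induction l with
    | nil => intro _; exact zero
    | cons a l ih =>
      intro h
      rw [List.pairwise_cons] at h
      exact cons a l (by simpa using h.1) (ih h.2)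
  simpa using key (α.sort (· ≤ ·)) (Multiset.pairwise_sort α _)

lemma map_orderedMonomial {B : Type*} [Ring B] [Algebra k B] (f : A →ₐ[k] B) (x : S → A)
    (α : Multiset S) : f (orderedMonomial x α) = orderedMonomial (fun s => f (x s)) α := by
  simp [orderedMonomial, map_list_prod, Function.comp_def]

/-- Words can be rewritten as combinations of ordered monomials when the commutators of the letters
are combinations of letters. -/
theorem word_mem_span_orderedMonomial {x : S → A} {d : S → ℕ} {F : ℕ → Submodule k A}
    (hl : ∀ s n, ∀ y ∈ F n, x s * y ∈ F (d s + n))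
    (hr : ∀ s n, ∀ y ∈ F n, y * x s ∈ F (n + d s))
    (hc : ∀ s t, x s * x t - x t * x s ∈
      Submodule.span k (x '' {u | d u = d s + d t}) ⊔ F (d s + d t + 1)) (l : List S) :
    (l.map x).prod ∈ Submodule.span k (orderedMonomial x '' {α | (α.map d).sum = (l.map d).sum}) ⊔
      F ((l.map d).sum + 1) := by
  induction h : l.length using Nat.strong_induction_on generalizing l with
  | _ m ih =>
  subst h
  have hp : l.Perm ((l : Multiset S).sort (· ≤ ·)) := by
    rw [← Multiset.coe_eq_coe, Multiset.sort_eq]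
  have h1 := word_sub_word_mem_of_perm hl hr hc hp
  rw [← sub_add_cancel (l.map x).prod (((l : Multiset S).sort (· ≤ ·)).map x).prod]
  refine add_mem ?_ (Submodule.mem_sup_left (Submodule.subset_span ⟨(l : Multiset S), ?_, rfl⟩))
  · refine (sup_le (Submodule.span_le.2 ?_) le_sup_right :
      shorterWords x d F l.length (l.map d).sum ≤ _) h1
    rintro _ ⟨l', hl', hd, rfl⟩
    have := ih _ hl' l' rfl
    rwa [hd] at this
  · simp

end OrderedMonomial

end GradedHopf

namespace GradedHopf

open TensorProduct

/-! ### Dual functionals and the filtration on the tensor square -/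

section Dual

variable {k : Type*} {M : Type*} {ι : Type*} [Field k] [AddCommGroup M] [Module k M]

/-- A family that is linearly independent modulo `N` has dual functionals that vanish on `N`. -/
lemma exists_dual_of_linearIndepOn_mkQ {N : Submodule k M} {v : ι → M} {T : Set ι}
    (h : LinearIndepOn k (N.mkQ ∘ v) T) {i : ι} (hi : i ∈ T) :
    ∃ f : M →ₗ[k] k, (∀ y ∈ N, f y = 0) ∧ f (v i) = 1 ∧ ∀ j ∈ T, j ≠ i → f (v j) = 0 := by
  classical
  have h' : LinearIndependent k (fun j : T => N.mkQ (v j)) := h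
  obtain ⟨g, hg⟩ := LinearMap.exists_extend ((Finsupp.lapply (⟨i, hi⟩ : T)) ∘ₗ h'.repr)
  have key : ∀ j : T, g (N.mkQ (v j)) = if j = ⟨i, hi⟩ then 1 else 0 := by
    intro j
    have := LinearMap.congr_fun hg ⟨N.mkQ (v j), Submodule.subset_span ⟨j, rfl⟩⟩
    simp only [LinearMap.comp_apply, Submodule.subtype_apply] at this
    rw [this, Finsupp.lapply_apply]
    have h2 := h'.repr_eq_single j ⟨N.mkQ (v j), Submodule.subset_span ⟨j, rfl⟩⟩ rfl
    rw [h2, Finsupp.single_apply]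
  refine ⟨g ∘ₗ N.mkQ, fun y hy => ?_, ?_, fun j hj hne => ?_⟩
  · simp [(Submodule.Quotient.mk_eq_zero N).2 hy]
  · simpa using key ⟨i, hi⟩
  · simpa [hne] using key ⟨j, hj⟩

end Dual

section Tensor

variable {k : Type*} {A : Type*} [Field k] [Ring A] [Algebra k A]

/-- The filtration `∑ F i ⊗ F j`, `n ≤ i + j`, on `A ⊗ A` induced by a filtration `F` of `A`. -/
def tensorFiltration (F : ℕ → Submodule k A) (n : ℕ) : Submodule k (A ⊗[k] A) :=
  Submodule.span k {z | ∃ i j, n ≤ i + j ∧ ∃ a ∈ F i, ∃ b ∈ F j, a ⊗ₜ[k] b = z}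

lemma tmul_mem_tensorFiltration {F : ℕ → Submodule k A} {n i j : ℕ} (h : n ≤ i + j) {a b : A}
    (ha : a ∈ F i) (hb : b ∈ F j) : a ⊗ₜ[k] b ∈ tensorFiltration F n :=
  Submodule.subset_span ⟨i, j, h, a, ha, b, hb, rfl⟩

lemma tensorFiltration_antitone (F : ℕ → Submodule k A) : Antitone (tensorFiltration F) := by
  refine fun m n h => Submodule.span_mono ?_
  rintro z ⟨i, j, hij, h'⟩
  exact ⟨i, j, h.trans hij, h'⟩

lemma tensorFiltration_mul_le {F : ℕ → Submodule k A} (hmul : ∀ i j, F i * F j ≤ F (i + j))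
    (m n : ℕ) : tensorFiltration F m * tensorFiltration F n ≤ tensorFiltration F (m + n) := by
  rw [tensorFiltration, tensorFiltration, Submodule.span_mul_span, Submodule.span_le]
  rintro _ ⟨_, ⟨i, j, hij, a, ha, b, hb, rfl⟩, _, ⟨i', j', hij', a', ha', b', hb', rfl⟩, rfl⟩
  simp only [Algebra.TensorProduct.tmul_mul_tmul, SetLike.mem_coe]
  exact tmul_mem_tensorFiltration (by omega) (hmul _ _ (Submodule.mul_mem_mul ha ha'))
    (hmul _ _ (Submodule.mul_mem_mul hb hb'))

/-- Pigeonhole: if `i + j` exceeds `p + q`, then `i > p` or `j > q`, so one of the functionals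
vanishes on its factor. -/
lemma map_mul_eq_zero_of_mem_tensorFiltration {F : ℕ → Submodule k A} (hanti : Antitone F)
    {p q n : ℕ} (h : p + q < n) {f g : A →ₗ[k] k} (hf : ∀ y ∈ F (p + 1), f y = 0)
    (hg : ∀ y ∈ F (q + 1), g y = 0) {z : A ⊗[k] A} (hz : z ∈ tensorFiltration F n) :
    (LinearMap.mul' k k ∘ₗ TensorProduct.map f g) z = 0 := by
  refine (Submodule.span_le.2 ?_ : tensorFiltration F n ≤ LinearMap.ker _) hz
  rintro _ ⟨i, j, hij, a, ha, b, hb, rfl⟩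
  simp only [SetLike.mem_coe, LinearMap.mem_ker, LinearMap.comp_apply, TensorProduct.map_tmul,
    LinearMap.mul'_apply]
  rcases le_or_gt (p + 1) i with hi | hi
  · rw [hf a (hanti hi ha), zero_mul]
  · rw [hg b (hanti (by omega) hb), mul_zero]

end Tensor

lemma sum_map_ite_eq_count {k ι : Type*} [Semiring k] [DecidableEq ι] (a : ι) (m : Multiset ι) :
    (m.map fun p => if a = p then (1 : k) else 0).sum = (m.count a : k) := by
  induction m using Multiset.induction_on with
  | empty => simp
  | cons b m ih => rw [Multiset.map_cons, Multiset.sum_cons, ih, Multiset.count_cons]; split_ifs <;>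
      simp [add_comm]

/-! ### Independence of ordered monomials in leading primitives -/

section Independence

variable {k : Type*} {A : Type*} {S : Type*} [Field k] [Ring A] [Algebra k A] [LinearOrder S]
  {F : ℕ → Submodule k A} {x : S → A} {d : S → ℕ}

lemma orderedMonomial_mem (h0 : (1 : A) ∈ F 0) (hmul : ∀ i j, F i * F j ≤ F (i + j))
    (hx : ∀ s, x s ∈ F (d s)) (α : Multiset S) : orderedMonomial x α ∈ F (α.map d).sum := by
  induction α using orderedMonomial_induction with
  | zero => simpa using h0
  | cons s α hs ih =>
    rw [orderedMonomial_cons x hs, Multiset.map_cons, Multiset.sum_cons]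
    exact hmul _ _ (Submodule.mul_mem_mul (hx s) ih)

/-- The leading term of the coproduct of an ordered monomial. -/
def splitSum (k : Type*) {A : Type*} {S : Type*} [Field k] [Ring A] [Algebra k A] [LinearOrder S]
    (x : S → A) (α : Multiset S) : A ⊗[k] A :=
  (α.antidiagonal.map fun p => orderedMonomial x p.1 ⊗ₜ[k] orderedMonomial x p.2).sum

/-- Each splitting of `s ::ₘ α` puts the new `s` in the left or the right part, and `s` is minimal,
so both parts stay ordered. -/
lemma splitSum_cons (x : S → A) {s : S} {α : Multiset S} (h : ∀ b ∈ α, s ≤ b) :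
    splitSum k x (s ::ₘ α) = (x s ⊗ₜ[k] 1 + 1 ⊗ₜ[k] x s) * splitSum k x α := by
  simp only [splitSum, Multiset.antidiagonal_cons, Multiset.map_add, Multiset.sum_add,
    Multiset.map_map, ← Multiset.sum_map_mul_left]
  rw [add_comm, ← Multiset.sum_map_add]
  refine congrArg _ (Multiset.map_congr rfl fun p hp => ?_)
  rw [Multiset.mem_antidiagonal] at hp
  have h1 : ∀ b ∈ p.1, s ≤ b := fun b hb => h b (hp ▸ Multiset.mem_add.2 (Or.inl hb))
  have h2 : ∀ b ∈ p.2, s ≤ b := fun b hb => h b (hp ▸ Multiset.mem_add.2 (Or.inr hb))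
  simp [add_mul, orderedMonomial_cons x h1, orderedMonomial_cons x h2]

lemma splitSum_mem (h0 : (1 : A) ∈ F 0) (hmul : ∀ i j, F i * F j ≤ F (i + j))
    (hx : ∀ s, x s ∈ F (d s)) (α : Multiset S) :
    splitSum k x α ∈ tensorFiltration F (α.map d).sum := by
  refine multiset_sum_mem _ fun z hz => ?_
  obtain ⟨p, hp, rfl⟩ := Multiset.mem_map.1 hz
  rw [Multiset.mem_antidiagonal] at hp
  subst hp
  exact tmul_mem_tensorFiltration (by simp) (orderedMonomial_mem h0 hmul hx _)
    (orderedMonomial_mem h0 hmul hx _)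

/-- If the `x s` are primitive to leading order, then the coproduct of an ordered monomial is
`splitSum` to leading order. -/
lemma comul_orderedMonomial_sub_mem {Δ : A →ₐ[k] A ⊗[k] A} (h0 : (1 : A) ∈ F 0)
    (hmul : ∀ i j, F i * F j ≤ F (i + j)) (hx : ∀ s, x s ∈ F (d s))
    (hΔ : ∀ s, Δ (x s) - (x s ⊗ₜ[k] 1 + 1 ⊗ₜ[k] x s) ∈ tensorFiltration F (d s + 1))
    (α : Multiset S) :
    Δ (orderedMonomial x α) - splitSum k x α ∈ tensorFiltration F ((α.map d).sum + 1) := by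
  induction α using orderedMonomial_induction with
  | zero => simp [splitSum, Algebra.TensorProduct.one_def]
  | cons s α hs ih =>
    rw [orderedMonomial_cons x hs, splitSum_cons x hs, map_mul]
    have hP : x s ⊗ₜ[k] 1 + 1 ⊗ₜ[k] x s ∈ tensorFiltration F (d s) :=
      add_mem (tmul_mem_tensorFiltration (by simp) (hx s) h0)
        (tmul_mem_tensorFiltration (by simp) h0 (hx s))
    have hQ := splitSum_mem h0 hmul hx α
    set P := x s ⊗ₜ[k] (1 : A) + 1 ⊗ₜ[k] x s
    set Q := splitSum k x α
    have hD : Δ (orderedMonomial x α) ∈ tensorFiltration F (α.map d).sum := by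
      have := add_mem (tensorFiltration_antitone F (Nat.le_succ _) ih) hQ
      simpa using this
    have e : Δ (x s) * Δ (orderedMonomial x α) - P * Q =
        (Δ (x s) - P) * Δ (orderedMonomial x α) + P * (Δ (orderedMonomial x α) - Q) := by
      noncomm_ring
    rw [e, Multiset.map_cons, Multiset.sum_cons]
    refine add_mem ?_ ?_
    · have := tensorFiltration_mul_le hmul _ _ (Submodule.mul_mem_mul (hΔ s) hD)
      exact tensorFiltration_antitone F (by omega) this
    · have := tensorFiltration_mul_le hmul _ _ (Submodule.mul_mem_mul hP ih)
      exact tensorFiltration_antitone F (by omega) this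

/-- Ordered monomials in elements that are primitive to leading order are linearly independent to
leading order, provided these elements are. -/
theorem linearIndepOn_orderedMonomial [CharZero k] {Δ : A →ₐ[k] A ⊗[k] A} (h0 : (1 : A) ∈ F 0)
    (hmul : ∀ i j, F i * F j ≤ F (i + j)) (hanti : Antitone F) (h1 : (1 : A) ∉ F 1)
    (hd : ∀ s, 0 < d s) (hx : ∀ s, x s ∈ F (d s))
    (hF : ∀ n, ∀ y ∈ F n, Δ y ∈ tensorFiltration F n)
    (hΔ : ∀ s, Δ (x s) - (x s ⊗ₜ[k] 1 + 1 ⊗ₜ[k] x s) ∈ tensorFiltration F (d s + 1))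
    (hind : ∀ n, LinearIndepOn k ((F (n + 1)).mkQ ∘ x) {s | d s = n}) (n : ℕ) :
    LinearIndepOn k ((F (n + 1)).mkQ ∘ orderedMonomial x) {α | (α.map d).sum = n} := by
  classical
  have hpos : ∀ α : Multiset S, α ≠ 0 → 0 < (α.map d).sum := by
    intro α hα
    obtain ⟨s, hs⟩ := Multiset.exists_mem_of_ne_zero hα
    exact (hd s).trans_le (Multiset.single_le_sum (by simp) _ (Multiset.mem_map_of_mem d hs))
  induction n using Nat.strong_induction_on with
  | _ n ih =>
  rw [linearIndepOn_iff]
  intro c hc hsum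
  rw [← Finsupp.apply_linearCombination, Submodule.mkQ_apply, Submodule.Quotient.mk_eq_zero] at hsum
  have hdeg : ∀ α ∈ c.support, (α.map d).sum = n := fun α hα => hc hα
  -- only singletons can contribute
  have hbig : ∀ s β, β ≠ 0 → c (s ::ₘ β) = 0 := by
    intro s β hβ
    by_contra hne
    have hn : d s + (β.map d).sum = n := by
      simpa using hdeg _ (Finsupp.mem_support_iff.2 hne)
    have hβ' := hpos β hβ
    have hs' := hd s
    -- Both `{s}` and `β` have degree below `n`, so the induction hypothesis provides dual
    -- functionals; `f ⊗ g` then detects the splitting `({s}, β)`.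
    obtain ⟨f, hf, hf1, hf0⟩ := exists_dual_of_linearIndepOn_mkQ (ih (d s) (by omega))
      (i := {s}) (by simp)
    obtain ⟨g, hg, hg1, hg0⟩ := exists_dual_of_linearIndepOn_mkQ (ih (β.map d).sum (by omega))
      (i := β) rfl
    have hvan : ∀ z ∈ tensorFiltration F (n + 1),
        (LinearMap.mul' k k ∘ₗ TensorProduct.map f g) z = 0 := fun z hz =>
      map_mul_eq_zero_of_mem_tensorFiltration hanti (by omega) hf hg hz
    set φ := LinearMap.mul' k k ∘ₗ TensorProduct.map f g with hφ
    have hmon : ∀ α ∈ c.support, φ (Δ (orderedMonomial x α)) =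
        (α.antidiagonal.count ({s}, β) : k) := by
      intro α hα
      have h2 := hvan _ (hdeg α hα ▸ comul_orderedMonomial_sub_mem h0 hmul hx hΔ α)
      rw [map_sub, sub_eq_zero] at h2
      rw [h2, splitSum, map_multiset_sum, Multiset.map_map]
      have h3 : ∀ p ∈ α.antidiagonal, (φ ∘ fun p : Multiset S × Multiset S =>
          orderedMonomial x p.1 ⊗ₜ[k] orderedMonomial x p.2) p =
          if ({s}, β) = p then 1 else 0 := by
        rintro ⟨p, q⟩ hp
        rw [Multiset.mem_antidiagonal] at hp
        have hpq : (p.map d).sum + (q.map d).sum = n := by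
          rw [← hdeg α hα, ← hp]; simp
        have e1 := orderedMonomial_mem h0 hmul hx p
        have e2 := orderedMonomial_mem h0 hmul hx q
        simp only [Function.comp_apply, hφ, LinearMap.comp_apply, TensorProduct.map_tmul,
          LinearMap.mul'_apply, Prod.mk.injEq]
        -- Unless the left part has degree exactly `d s`, one of the two parts is too deep in `F`
        -- for its functional to see it.
        rcases lt_trichotomy (p.map d).sum (d s) with hlt | heq | hgt
        · rw [hg _ (hanti (by omega) e2), mul_zero, if_neg]
          rintro ⟨rfl, rfl⟩
          simp at hlt
        · by_cases hps : p = {s}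
          · subst hps
            by_cases hqβ : q = β
            · subst hqβ
              simp only [orderedMonomial_singleton] at hf1 ⊢
              simp [hf1, hg1]
            · rw [hg0 q (by simp only [Set.mem_ofPred_eq]; omega) hqβ, mul_zero, if_neg]
              rintro ⟨_, h⟩
              exact hqβ h.symm
          · rw [hf0 p heq hps, zero_mul, if_neg]
            rintro ⟨h, _⟩
            exact hps h.symm
        · rw [hf _ (hanti (by omega) e1), zero_mul, if_neg]
          rintro ⟨rfl, rfl⟩
          simp at hgt
      rw [Multiset.map_congr rfl h3, sum_map_ite_eq_count]
    have hz := hvan _ (hF _ _ hsum)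
    rw [Finsupp.linearCombination_apply, Finsupp.sum, map_sum, map_sum,
      Finset.sum_eq_single (s ::ₘ β)] at hz
    -- The coefficient of `({s}, β)` is a positive integer, and characteristic zero keeps it nonzero
    -- in `k`.
    · rw [map_smul, map_smul, hmon _ (Finsupp.mem_support_iff.2 hne), smul_eq_mul,
        mul_eq_zero, Nat.cast_eq_zero, Multiset.count_eq_zero, Multiset.mem_antidiagonal] at hz
      rcases hz with hz | hz
      · exact hne hz
      · exact hz (by simp)
    · intro α hα hne'
      rw [map_smul, map_smul, hmon α hα, Multiset.count_eq_zero_of_notMem, Nat.cast_zero, smul_zero]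
      rw [Multiset.mem_antidiagonal]
      exact fun h => hne' (by simpa using h.symm)
    · intro h
      exact absurd (Finsupp.mem_support_iff.2 hne) h
  ext α
  rw [Finsupp.zero_apply]
  by_contra hne
  have hα := hdeg α (Finsupp.mem_support_iff.2 hne)
  induction α using Multiset.induction_on with
  | empty =>
    have hn : n = 0 := by simpa using hα.symm
    subst hn
    -- In degree zero only the empty monomial `1` exists, and it does not lie in `F 1`.
    have hc0 : c = Finsupp.single 0 (c 0) := by
      rw [Finsupp.eq_single_iff]
      refine ⟨fun α hα => ?_, rfl⟩
      by_contra hne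
      exact (hpos α (by simpa using hne)).ne' (hdeg α hα)
    rw [hc0, Finsupp.linearCombination_single, orderedMonomial_zero,
      Submodule.smul_mem_iff _ hne] at hsum
    exact h1 hsum
  | cons s β _ =>
    rcases eq_or_ne β 0 with rfl | hβ
    · obtain ⟨f, hf, hf1, hf0⟩ := exists_dual_of_linearIndepOn_mkQ (hind n) (i := s)
        (by simpa using hα)
      have hz := hf _ hsum
      rw [Finsupp.linearCombination_apply, Finsupp.sum, map_sum, Finset.sum_eq_single {s}] at hz
      · simp only [orderedMonomial_singleton, map_smul, hf1, smul_eq_mul, mul_one] at hz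
        exact hne hz
      · intro α hα' hαs
        rw [map_smul]
        induction α using Multiset.induction_on with
        | empty =>
          have h3 := hdeg _ hα'
          have h4 := hd s
          simp at h3 hα
          omega
        | cons t γ _ =>
          rcases eq_or_ne γ 0 with rfl | hγ
          · have ht : d t = n := by simpa using hdeg _ hα'
            rw [Multiset.cons_zero, orderedMonomial_singleton,
              hf0 t ht (fun h => hαs (by simp [h])), smul_zero]
          · rw [hbig t γ hγ, zero_smul]
      · intro h
        exact absurd (Finsupp.mem_support_iff.2 hne) h
    · exact hne (hbig s β hβ)

end Independence

end GradedHopf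

namespace GradedHopf

open TensorProduct

/-! ### Twisting the coproduct so that the augmentation is its counit -/

section Augmentation

/-- The augmentation of a connected graded algebra. -/
lemma exists_augmentation {k : Type*} {A : Type*} [Field k] [Ring A] [Nontrivial A] [Algebra k A]
    (𝒜 : ℕ → Submodule k A) [GradedAlgebra 𝒜] (hconn : IsConnected 𝒜) :
    ∃ χ : A →ₐ[k] k, ∀ a, algebraMap k A (χ a) = GradedAlgebra.proj 𝒜 0 a := by
  have hinj : Function.Injective (algebraMap k A) := (algebraMap k A).injective
  have hex : ∀ a : A, ∃ c : k, algebraMap k A c = GradedRing.projZeroRingHom 𝒜 a := by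
    intro a
    have h : GradedRing.projZeroRingHom 𝒜 a ∈ 𝒜 0 := SetLike.coe_mem _
    have h0 : 𝒜 0 = 1 := hconn
    rw [h0] at h
    exact Submodule.mem_one.1 h
  choose f hf using hex
  refine ⟨AlgHom.mk ⟨⟨⟨f, ?_⟩, ?_⟩, ?_, ?_⟩ ?_, hf⟩
  · exact hinj (by rw [hf, map_one, map_one])
  · intro a b; exact hinj (by simp only [hf, map_mul])
  · exact hinj (by simp only [hf, map_zero])
  · intro a b; exact hinj (by simp only [hf, map_add])
  · intro c
    refine hinj ?_
    rw [show algebraMap k A (f (algebraMap k A c)) = _ from hf _]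
    exact DirectSum.decompose_of_mem_same 𝒜 (SetLike.algebraMap_mem_graded 𝒜 c)

open WithConv Coalgebra in
/-- Twisting the coproduct of a Hopf algebra by a character `χ` produces a coproduct (as an algebra
homomorphism) with counit `χ`. -/
lemma exists_comul_with_counit {k : Type*} {H : Type*} [Field k] [Ring H] [HopfAlgebra k H]
    (χ : H →ₐ[k] k) :
    ∃ D : H →ₐ[k] H ⊗[k] H,
      (∀ h, TensorProduct.lid k H (TensorProduct.map χ.toLinearMap LinearMap.id (D h)) = h) ∧
      (∀ h, TensorProduct.rid k H (TensorProduct.map LinearMap.id χ.toLinearMap (D h)) = h) := by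
  -- The antipode reverses products, but `k` is commutative, so `χ ∘ S` is again a character: the
  -- convolution inverse of `χ`.
  let χ' : H →ₐ[k] k := AlgHom.ofLinearMap (χ.toLinearMap ∘ₗ HopfAlgebra.antipode k)
    (by simp) (fun a b => by simp [HopfAlgebra.antipode_mul_antidistrib, mul_comm])
  let q : H →ₐ[k] H := (Algebra.ofId k H).comp χ
  let u : WithConv (H →ₗ[k] H) := toConv q.toLinearMap
  let u' : WithConv (H →ₗ[k] H) := toConv (q.toLinearMap ∘ₗ HopfAlgebra.antipode k)
  let i : WithConv (H →ₗ[k] H) := toConv LinearMap.id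
  have hone : q.toLinearMap ∘ₗ (1 : WithConv (H →ₗ[k] H)).ofConv =
      (1 : WithConv (H →ₗ[k] H)).ofConv := by
    ext h; simp
  have huu' : u * u' = 1 := by
    have h := LinearMap.algHom_comp_convMul_distrib q i (toConv (HopfAlgebra.antipode k))
    rw [LinearMap.id_mul_antipode, hone] at h
    exact WithConv.ofConv_injective h.symm
  have hu'u : u' * u = 1 := by
    have h := LinearMap.algHom_comp_convMul_distrib q (toConv (HopfAlgebra.antipode k)) i
    rw [LinearMap.antipode_mul_id, hone] at h
    exact WithConv.ofConv_injective h.symm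
  -- In convolution terms `wind = χ⁻¹ * id`. For `D = (id ⊗ wind) Δ`, applying `χ` on the left gives
  -- `χ * χ⁻¹ * id = id`, and on the right `id * (χ⁻¹ * χ) = id`.
  let wind : H →ₐ[k] H := (Algebra.TensorProduct.lid k H).toAlgHom.comp
    ((Algebra.TensorProduct.map χ' (AlgHom.id k H)).comp (Bialgebra.comulAlgHom k H))
  have hwind : toConv wind.toLinearMap = u' * i := by
    ext h
    have e : (TensorProduct.lid k H).toLinearMap ∘ₗ
        TensorProduct.map χ'.toLinearMap LinearMap.id =
        LinearMap.mul' k H ∘ₗ TensorProduct.map u'.ofConv i.ofConv := by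
      ext a b
      simp [χ', u', i, q, Algebra.smul_def, Algebra.ofId_apply]
      rfl
    exact LinearMap.congr_fun e (comul h)
  refine ⟨(Algebra.TensorProduct.map (AlgHom.id k H) wind).comp (Bialgebra.comulAlgHom k H),
    fun h => ?_, fun h => ?_⟩
  · have e : (TensorProduct.lid k H).toLinearMap ∘ₗ
        TensorProduct.map χ.toLinearMap LinearMap.id ∘ₗ
        TensorProduct.map LinearMap.id wind.toLinearMap =
        LinearMap.mul' k H ∘ₗ TensorProduct.map u.ofConv (toConv wind.toLinearMap).ofConv := by
      ext a b; simp [u, q, Algebra.smul_def, Algebra.ofId_apply]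
    have e2 := LinearMap.congr_fun e (comul h)
    have e3 : (u * toConv wind.toLinearMap) h = h := by
      rw [hwind, ← mul_assoc, huu', one_mul]; rfl
    exact e2.trans e3
  · have e : (TensorProduct.rid k H).toLinearMap ∘ₗ
        TensorProduct.map LinearMap.id χ.toLinearMap ∘ₗ
        TensorProduct.map LinearMap.id wind.toLinearMap =
        LinearMap.mul' k H ∘ₗ TensorProduct.map i.ofConv (q.toLinearMap ∘ₗ wind.toLinearMap) := by
      ext a b; simp [i, q, Algebra.smul_def, Algebra.ofId_apply, Algebra.commutes]
    have e2 := LinearMap.congr_fun e (comul h)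
    have hq : toConv (q.toLinearMap ∘ₗ wind.toLinearMap) = 1 := by
      have h := LinearMap.algHom_comp_convMul_distrib q u' i
      rw [← hwind] at h
      have hqq : q.toLinearMap ∘ₗ u'.ofConv = u'.ofConv := by
        ext a; simp [u', q, Algebra.ofId_apply]
      rw [hqq] at h
      have h2 : toConv (q.toLinearMap ∘ₗ wind.toLinearMap) = u' * u :=
        WithConv.ofConv_injective h
      rw [h2, hu'u]
    have e3 : (i * toConv (q.toLinearMap ∘ₗ wind.toLinearMap)) h = h := by
      rw [hq, mul_one]; rfl
    exact e2.trans e3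

/-- If `D` has the counit `χ`, elements of the kernel of `χ` are primitive to leading order. -/
lemma comul_sub_mem_of_counit {k : Type*} {A : Type*} [Field k] [Ring A] [Algebra k A]
    {χ : A →ₐ[k] k} {D : A →ₐ[k] A ⊗[k] A}
    (hl : ∀ h, TensorProduct.lid k A (TensorProduct.map χ.toLinearMap LinearMap.id (D h)) = h)
    (hr : ∀ h, TensorProduct.rid k A (TensorProduct.map LinearMap.id χ.toLinearMap (D h)) = h)
    {a : A} (ha : χ a = 0) :
    D a - (a ⊗ₜ[k] 1 + 1 ⊗ₜ[k] a) ∈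
      Submodule.span k {z | ∃ x y, χ x = 0 ∧ χ y = 0 ∧ x ⊗ₜ[k] y = z} := by
  let η : k →ₗ[k] A := Algebra.linearMap k A
  -- `p` projects onto `ker χ`; expanding `(p ⊗ p) (D a)` with the two counit identities gives
  -- exactly the reduced coproduct when `χ a = 0`.
  let p : A →ₗ[k] A := LinearMap.id - η ∘ₗ χ.toLinearMap
  have hp : ∀ x, χ (p x) = 0 := fun x => by simp [p, η]
  have hmem : ∀ z : A ⊗[k] A, TensorProduct.map p p z ∈
      Submodule.span k {z | ∃ x y, χ x = 0 ∧ χ y = 0 ∧ x ⊗ₜ[k] y = z} := by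
    intro z
    induction z using TensorProduct.induction_on with
    | zero => simp
    | tmul x y =>
      rw [TensorProduct.map_tmul]
      exact Submodule.subset_span ⟨_, _, hp x, hp y, rfl⟩
    | add x y hx hy => rw [map_add]; exact add_mem hx hy
  have e1 : ∀ z : A ⊗[k] A, TensorProduct.map (η ∘ₗ χ.toLinearMap) LinearMap.id z =
      1 ⊗ₜ[k] TensorProduct.lid k A (TensorProduct.map χ.toLinearMap LinearMap.id z) := by
    intro z
    induction z using TensorProduct.induction_on with
    | zero => simp
    | tmul x y => simp [η, Algebra.algebraMap_eq_smul_one, TensorProduct.smul_tmul]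
    | add x y hx hy => simp only [map_add, hx, hy, TensorProduct.tmul_add]
  have e2 : ∀ z : A ⊗[k] A, TensorProduct.map LinearMap.id (η ∘ₗ χ.toLinearMap) z =
      TensorProduct.rid k A (TensorProduct.map LinearMap.id χ.toLinearMap z) ⊗ₜ[k] 1 := by
    intro z
    induction z using TensorProduct.induction_on with
    | zero => simp
    | tmul x y => simp [η, Algebra.algebraMap_eq_smul_one, TensorProduct.smul_tmul]
    | add x y hx hy => simp only [map_add, hx, hy, TensorProduct.add_tmul]
  have e3 : ∀ z : A ⊗[k] A, TensorProduct.map p p z =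
      z - TensorProduct.map LinearMap.id (η ∘ₗ χ.toLinearMap) z -
        TensorProduct.map (η ∘ₗ χ.toLinearMap)
          LinearMap.id (z - TensorProduct.map LinearMap.id (η ∘ₗ χ.toLinearMap) z) := by
    intro z
    induction z using TensorProduct.induction_on with
    | zero => simp
    | tmul x y => simp [p, TensorProduct.sub_tmul, TensorProduct.tmul_sub]; abel
    | add x y hx hy => rw [map_add, hx, hy]; simp only [map_add, map_sub]; abel
  have h := hmem (D a)
  rw [e3, e2, hr, map_sub, e1, hl, TensorProduct.map_tmul] at h
  convert h using 1
  simp [ha]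
  abel

end Augmentation

/-! ### Powers of the augmentation ideal and leading primitives -/

section AugFiltration

variable {k : Type*} {A : Type*} [Field k] [Ring A] [Algebra k A]

/-- The filtration by the powers of the kernel of a character `χ`. -/
def augFiltration (χ : A →ₐ[k] k) (n : ℕ) : Submodule k A :=
  LinearMap.ker χ.toLinearMap ^ n * ⊤

variable (χ : A →ₐ[k] k)

lemma ker_mul_top : LinearMap.ker χ.toLinearMap * ⊤ = LinearMap.ker χ.toLinearMap := by
  refine le_antisymm (Submodule.mul_le.2 fun a ha b _ => ?_) fun a ha => ?_
  · have : χ a = 0 := ha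
    simp [this]
  · simpa using Submodule.mul_mem_mul ha (Submodule.mem_top (x := (1 : A)))

lemma top_mul_ker : ⊤ * LinearMap.ker χ.toLinearMap = LinearMap.ker χ.toLinearMap := by
  refine le_antisymm (Submodule.mul_le.2 fun a _ b hb => ?_) fun a ha => ?_
  · have : χ b = 0 := hb
    simp [this]
  · simpa using Submodule.mul_mem_mul (Submodule.mem_top (x := (1 : A))) ha

lemma top_mul_top' : (⊤ : Submodule k A) * ⊤ = ⊤ :=
  top_le_iff.1 fun a _ => by
    simpa using Submodule.mul_mem_mul (Submodule.mem_top (x := a)) (Submodule.mem_top (x := (1 : A)))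

/-- The factor `⊤` in the definition serves this case: the zeroth power of a submodule is only `k ·
1`. In positive degree it is absorbed by the ideal. -/
lemma augFiltration_zero : augFiltration χ 0 = ⊤ := by simp [augFiltration]

lemma augFiltration_one : augFiltration χ 1 = LinearMap.ker χ.toLinearMap := by
  rw [augFiltration, pow_one, ker_mul_top]

lemma augFiltration_mul (m n : ℕ) :
    augFiltration χ m * augFiltration χ n = augFiltration χ (m + n) := by
  have hcomm : Commute (⊤ : Submodule k A) (LinearMap.ker χ.toLinearMap ^ n) :=
    Commute.pow_right (by rw [Commute, SemiconjBy, ker_mul_top, top_mul_ker]) n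
  rw [augFiltration, augFiltration, augFiltration, mul_assoc, ← mul_assoc ⊤, hcomm.eq,
    mul_assoc, top_mul_top', ← mul_assoc, pow_add]

lemma augFiltration_antitone : Antitone (augFiltration χ) := by
  refine antitone_nat_of_succ_le fun n => ?_
  rw [augFiltration, augFiltration, pow_succ, mul_assoc, ker_mul_top]
  exact mul_le_mul' le_rfl le_top

lemma one_notMem_augFiltration_one : (1 : A) ∉ augFiltration χ 1 := by
  rw [augFiltration_one]; simp

variable {χ} {D : A →ₐ[k] A ⊗[k] A}

lemma comul_sub_mem_tensorFiltration
    (hD : ∀ a, χ a = 0 → D a - (a ⊗ₜ[k] 1 + 1 ⊗ₜ[k] a) ∈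
      Submodule.span k {z | ∃ x y, χ x = 0 ∧ χ y = 0 ∧ x ⊗ₜ[k] y = z})
    {a : A} (ha : χ a = 0) :
    D a - (a ⊗ₜ[k] 1 + 1 ⊗ₜ[k] a) ∈ tensorFiltration (augFiltration χ) 2 := by
  refine Submodule.span_le.2 ?_ (hD a ha)
  rintro _ ⟨x, y, hx, hy, rfl⟩
  refine tmul_mem_tensorFiltration (i := 1) (j := 1) le_rfl ?_ ?_ <;> rw [augFiltration_one]
  exacts [hx, hy]

lemma tmul_one_add_mem {n : ℕ} {a : A} (ha : a ∈ augFiltration χ n) :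
    a ⊗ₜ[k] 1 + 1 ⊗ₜ[k] a ∈ tensorFiltration (augFiltration χ) n := by
  have h1 : (1 : A) ∈ augFiltration χ 0 := by rw [augFiltration_zero]; trivial
  exact add_mem (tmul_mem_tensorFiltration (by simp) ha h1)
        (tmul_mem_tensorFiltration (by simp) h1 ha)

/-- `D` is multiplicative and sends `ker χ` into filtration degree one, hence sends `n`-fold
products into degree `n`. -/
lemma comul_mem_tensorFiltration
    (hD : ∀ a, χ a = 0 → D a - (a ⊗ₜ[k] 1 + 1 ⊗ₜ[k] a) ∈
      Submodule.span k {z | ∃ x y, χ x = 0 ∧ χ y = 0 ∧ x ⊗ₜ[k] y = z})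
    (n : ℕ) : ∀ y ∈ augFiltration χ n, D y ∈ tensorFiltration (augFiltration χ) n := by
  induction n with
  | zero =>
    intro y _
    induction D y using TensorProduct.induction_on with
    | zero => simp
    | tmul a b =>
      refine tmul_mem_tensorFiltration (i := 0) (j := 0) le_rfl ?_ ?_ <;>
      · rw [augFiltration_zero]; trivial
    | add a b ha hb => exact add_mem ha hb
  | succ n ih =>
    intro y hy
    rw [← augFiltration_mul] at hy
    induction hy using Submodule.mul_induction_on' with
    | mem_mul_mem a ha b hb =>
      rw [map_mul]
      refine tensorFiltration_mul_le (fun i j => (augFiltration_mul χ i j).le) _ _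
        (Submodule.mul_mem_mul (ih a ha) ?_)
      have hb' : χ b = 0 := by rw [augFiltration_one] at hb; exact hb
      rw [← sub_add_cancel (D b) (b ⊗ₜ[k] 1 + 1 ⊗ₜ[k] b)]
      exact add_mem (tensorFiltration_antitone _ (by norm_num)
        (comul_sub_mem_tensorFiltration hD hb')) (tmul_one_add_mem hb)
    | add a _ b _ ha hb => rw [map_add]; exact add_mem ha hb

variable (χ D) in
/-- The elements of degree `n` in the filtration that are primitive to leading order. -/
def leadingPrimitives (n : ℕ) : Submodule k A :=
  augFiltration χ n ⊓ (tensorFiltration (augFiltration χ) (n + 1)).comap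
    (D.toLinearMap - ((TensorProduct.mk k A A).flip 1 + TensorProduct.mk k A A 1))

lemma mem_leadingPrimitives {n : ℕ} {a : A} : a ∈ leadingPrimitives χ D n ↔
    a ∈ augFiltration χ n ∧
      D a - (a ⊗ₜ[k] 1 + 1 ⊗ₜ[k] a) ∈ tensorFiltration (augFiltration χ) (n + 1) := by
  rw [leadingPrimitives, Submodule.mem_inf, Submodule.mem_comap]
  rfl

/-- The commutator of `a ⊗ 1 + 1 ⊗ a` and `b ⊗ 1 + 1 ⊗ b` has no mixed terms, and replacing `D a`,
`D b` by these leading terms costs one filtration step. -/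
lemma commutator_mem_leadingPrimitives {m n : ℕ} {a b : A} (ha : a ∈ leadingPrimitives χ D m)
    (hb : b ∈ leadingPrimitives χ D n) : a * b - b * a ∈ leadingPrimitives χ D (m + n) := by
  rw [mem_leadingPrimitives] at *
  have hFm : ∀ i j, augFiltration χ i * augFiltration χ j ≤ augFiltration χ (i + j) :=
    fun i j => (augFiltration_mul χ i j).le
  refine ⟨sub_mem (hFm _ _ (Submodule.mul_mem_mul ha.1 hb.1))
    (add_comm m n ▸ hFm _ _ (Submodule.mul_mem_mul hb.1 ha.1)), ?_⟩
  have hPa := tmul_one_add_mem ha.1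
  have hPb := tmul_one_add_mem hb.1
  have e : (a * b - b * a) ⊗ₜ[k] (1 : A) + 1 ⊗ₜ[k] (a * b - b * a) =
      (a ⊗ₜ[k] 1 + 1 ⊗ₜ[k] a) * (b ⊗ₜ[k] 1 + 1 ⊗ₜ[k] b) -
      (b ⊗ₜ[k] 1 + 1 ⊗ₜ[k] b) * (a ⊗ₜ[k] 1 + 1 ⊗ₜ[k] a) := by
    simp only [add_mul, mul_add, Algebra.TensorProduct.tmul_mul_tmul, one_mul, mul_one,
      TensorProduct.sub_tmul, TensorProduct.tmul_sub]
    abel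
  rw [e, map_sub, map_mul, map_mul]
  have ha' := ha.2
  have hb' := hb.2
  set P := a ⊗ₜ[k] (1 : A) + 1 ⊗ₜ[k] a
  set Q := b ⊗ₜ[k] (1 : A) + 1 ⊗ₜ[k] b
  have hDb : D b ∈ tensorFiltration (augFiltration χ) n := by
    rw [← sub_add_cancel (D b) Q]
    exact add_mem (tensorFiltration_antitone _ (by omega) hb') hPb
  have hDa : D a ∈ tensorFiltration (augFiltration χ) m := by
    rw [← sub_add_cancel (D a) P]
    exact add_mem (tensorFiltration_antitone _ (by omega) ha') hPa
  have e2 : D a * D b - D b * D a - (P * Q - Q * P) =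
      (D a - P) * D b + P * (D b - Q) - ((D b - Q) * D a + Q * (D a - P)) := by noncomm_ring
  rw [e2]
  have hT : ∀ {i j : ℕ} {y z : A ⊗[k] A}, y ∈ tensorFiltration (augFiltration χ) i →
      z ∈ tensorFiltration (augFiltration χ) j → m + n + 1 = i + j →
      y * z ∈ tensorFiltration (augFiltration χ) (m + n + 1) := by
    intro i j y z hy hz h
    rw [h]
    exact tensorFiltration_mul_le hFm _ _ (Submodule.mul_mem_mul hy hz)
  exact sub_mem (add_mem (hT ha' hDb (by omega)) (hT hPa hb' (by omega)))
    (add_mem (hT hb' hDa (by omega)) (hT hPb ha' (by omega)))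

end AugFiltration

end GradedHopf

namespace GradedHopf

open TensorProduct

/-! ### Lie words, bigraded by length and degree -/

section Graded

variable {k : Type*} {A : Type*} [Field k] [Ring A] [Algebra k A] (𝒜 : ℕ → Submodule k A)

/-- The span of the iterated commutators of weight `w` of `j` homogeneous elements of positive
degree. -/
def lieWords : ℕ → ℕ → Submodule k A
  | 0, _ => ⊥
  | 1, w => if w = 0 then ⊥ else 𝒜 w
  | j + 2, w => Submodule.span k {z | ∃ a b, 0 < a ∧ a + b = w ∧
      ∃ x ∈ 𝒜 a, ∃ y ∈ lieWords (j + 1) b, x * y - y * x = z}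

lemma lieWords_zero (w : ℕ) : lieWords 𝒜 0 w = ⊥ := by rw [lieWords]

lemma lieWords_one {w : ℕ} (hw : 0 < w) : lieWords 𝒜 1 w = 𝒜 w := by
  rw [lieWords, if_neg hw.ne']

lemma lieWords_one_zero : lieWords 𝒜 1 0 = ⊥ := by rw [lieWords, if_pos rfl]

variable {𝒜} in
lemma commutator_mem_lieWords_succ {j a b : ℕ} (ha : 0 < a) {x y : A} (hx : x ∈ 𝒜 a)
    (hy : y ∈ lieWords 𝒜 j b) : x * y - y * x ∈ lieWords 𝒜 (j + 1) (a + b) := by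
  cases j with
  | zero =>
    rw [lieWords_zero, Submodule.mem_bot] at hy
    simp [hy]
  | succ j =>
    rw [lieWords]
    exact Submodule.subset_span ⟨a, b, ha, rfl, x, hx, y, hy, rfl⟩

-- Lie words are nested to the right by definition; the Jacobi identity rewrites a bracket of two of
-- them in that form, by induction on the left length.
variable {𝒜} in
lemma commutator_mem_lieWords {i j a b : ℕ} {x y : A} (hx : x ∈ lieWords 𝒜 i a)
    (hy : y ∈ lieWords 𝒜 j b) : x * y - y * x ∈ lieWords 𝒜 (i + j) (a + b) := by
  induction i using Nat.strong_induction_on generalizing j a b x y with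
  | _ i ih =>
  revert hx
  match i, ih with
  | 0, _ =>
    intro hx
    rw [lieWords_zero, Submodule.mem_bot] at hx
    simp [hx]
  | 1, _ =>
    intro hx
    rcases Nat.eq_zero_or_pos a with rfl | ha
    · rw [lieWords_one_zero, Submodule.mem_bot] at hx
      simp [hx]
    · rw [lieWords_one 𝒜 ha] at hx
      rw [add_comm 1 j]
      exact commutator_mem_lieWords_succ ha hx hy
  | i + 2, ih =>
    intro hx
    rw [lieWords] at hx
    induction hx using Submodule.span_induction with
    | mem z hz =>
      obtain ⟨p, q, hp, rfl, z, hz, t, ht, rfl⟩ := hz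
      have h1 := commutator_mem_lieWords_succ hp hz (ih (i + 1) (by omega) ht hy)
      have h2 := ih (i + 1) (by omega) ht (commutator_mem_lieWords_succ hp hz hy)
      have e : (z * t - t * z) * y - y * (z * t - t * z) =
        (z * (t * y - y * t) - (t * y - y * t) * z) -
          (t * (z * y - y * z) - (z * y - y * z) * t) := by noncomm_ring
      rw [e]
      refine sub_mem ?_ ?_
      · convert h1 using 2 <;> ring
      · convert h2 using 2 <;> ring
    | zero => simp
    | add z t _ _ h1 h2 =>
      have e : (z + t) * y - y * (z + t) = (z * y - y * z) + (t * y - y * t) := by noncomm_ring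
      rw [e]; exact add_mem h1 h2
    | smul c z _ h =>
      rw [smul_mul_assoc, mul_smul_comm, ← smul_sub]; exact Submodule.smul_mem _ _ h

variable [GradedAlgebra 𝒜]

lemma lieWords_le (j w : ℕ) : lieWords 𝒜 j w ≤ 𝒜 w := by
  induction j using Nat.strong_induction_on generalizing w with
  | _ j ih =>
  match j, ih with
  | 0, _ => rw [lieWords_zero]; exact bot_le
  | 1, _ => rw [lieWords]; split_ifs <;> simp
  | j + 2, ih =>
    rw [lieWords, Submodule.span_le]
    rintro _ ⟨a, b, ha, rfl, x, hx, y, hy, rfl⟩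
    have hy' := ih (j + 1) (by omega) b hy
    exact sub_mem (SetLike.mul_mem_graded hx hy')
      (by rw [add_comm]; exact SetLike.mul_mem_graded hy' hx)

variable {𝒜} {χ : A →ₐ[k] k}

lemma augmentation_eq_zero_iff [Nontrivial A]
    (hχ : ∀ a, algebraMap k A (χ a) = GradedAlgebra.proj 𝒜 0 a) {a : A} :
    χ a = 0 ↔ GradedAlgebra.proj 𝒜 0 a = 0 := by
  rw [← hχ, FaithfulSMul.algebraMap_eq_zero_iff]

lemma proj_of_mem {a : A} {i : ℕ} (ha : a ∈ 𝒜 i) (j : ℕ) :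
    GradedAlgebra.proj 𝒜 j a = if i = j then a else 0 := by
  rw [GradedAlgebra.proj_apply]
  split_ifs with h
  · subst h; exact DirectSum.decompose_of_mem_same 𝒜 ha
  · exact DirectSum.decompose_of_mem_ne 𝒜 ha h

lemma homogeneous_le_augFiltration_one [Nontrivial A]
    (hχ : ∀ a, algebraMap k A (χ a) = GradedAlgebra.proj 𝒜 0 a) {i : ℕ} (hi : 0 < i) :
    𝒜 i ≤ augFiltration χ 1 := by
  intro a ha
  rw [augFiltration_one]
  exact (augmentation_eq_zero_iff hχ).2 (by rw [proj_of_mem ha, if_neg hi.ne'])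

/-- `ker χ` is spanned by homogeneous elements of positive degree, so its `n`th power is spanned by
homogeneous elements of degree at least `n`. This gives both homogeneity and separatedness of the
filtration. -/
lemma augFiltration_le_span [Nontrivial A]
    (hχ : ∀ a, algebraMap k A (χ a) = GradedAlgebra.proj 𝒜 0 a) (n : ℕ) :
    augFiltration χ n ≤ Submodule.span k {y | ∃ i, n ≤ i ∧ y ∈ 𝒜 i ∧ y ∈ augFiltration χ n} := by
  have h1 : augFiltration χ 1 ≤
      Submodule.span k {y | ∃ i, 1 ≤ i ∧ y ∈ 𝒜 i ∧ y ∈ augFiltration χ 1} := by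
    have key : ∀ a : A, a - GradedAlgebra.proj 𝒜 0 a ∈
        Submodule.span k {y | ∃ i, 1 ≤ i ∧ y ∈ 𝒜 i ∧ y ∈ augFiltration χ 1} := by
      intro a
      induction a using DirectSum.Decomposition.inductionOn 𝒜 with
      | zero => simp
      | @homogeneous i a =>
        rw [proj_of_mem a.2]
        split_ifs with h
        · simp
        · rw [sub_zero]
          exact Submodule.subset_span ⟨i, by omega, a.2,
            homogeneous_le_augFiltration_one hχ (by omega) a.2⟩
      | add a b ha hb => rw [map_add, add_sub_add_comm]; exact add_mem ha hb
    intro a ha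
    have := key a
    rw [augFiltration_one] at ha
    rwa [(augmentation_eq_zero_iff hχ).1 ha, sub_zero] at this
  induction n with
  | zero =>
    intro a _
    induction a using DirectSum.Decomposition.inductionOn 𝒜 with
    | zero => simp
    | @homogeneous i a =>
      exact Submodule.subset_span ⟨i, by omega, a.2, by rw [augFiltration_zero]; trivial⟩
    | add a b ha hb =>
      exact add_mem (ha (by rw [augFiltration_zero]; trivial))
        (hb (by rw [augFiltration_zero]; trivial))
  | succ n ih =>
    rw [← augFiltration_mul]
    refine (mul_le_mul' ih h1).trans ?_
    rw [Submodule.span_mul_span, Submodule.span_le]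
    rintro _ ⟨y, ⟨i, hi, hy, hy'⟩, z, ⟨j, hj, hz, hz'⟩, rfl⟩
    exact Submodule.subset_span ⟨i + j, by omega, SetLike.mul_mem_graded hy hz,
      Submodule.mul_mem_mul hy' hz'⟩

lemma proj_mem_augFiltration [Nontrivial A]
    (hχ : ∀ a, algebraMap k A (χ a) = GradedAlgebra.proj 𝒜 0 a) {n : ℕ} {a : A}
    (ha : a ∈ augFiltration χ n) (i : ℕ) : GradedAlgebra.proj 𝒜 i a ∈ augFiltration χ n := by
  refine (Submodule.span_le.2 ?_ : _ ≤ (augFiltration χ n).comap (GradedAlgebra.proj 𝒜 i))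
    (augFiltration_le_span hχ n ha)
  rintro y ⟨j, _, hy, hy'⟩
  rw [SetLike.mem_coe, Submodule.mem_comap, proj_of_mem hy]
  split_ifs
  · exact hy'
  · exact zero_mem _

lemma proj_eq_zero_of_mem_augFiltration [Nontrivial A]
    (hχ : ∀ a, algebraMap k A (χ a) = GradedAlgebra.proj 𝒜 0 a) {n : ℕ} {a : A}
    (ha : a ∈ augFiltration χ n) {i : ℕ} (hi : i < n) : GradedAlgebra.proj 𝒜 i a = 0 := by
  refine (Submodule.span_le.2 ?_ : _ ≤ LinearMap.ker (GradedAlgebra.proj 𝒜 i))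
    (augFiltration_le_span hχ n ha)
  rintro y ⟨j, hj, hy, hy'⟩
  rw [SetLike.mem_coe, LinearMap.mem_ker, proj_of_mem hy, if_neg (by omega)]

lemma eq_zero_of_mem_augFiltration [Nontrivial A]
    (hχ : ∀ a, algebraMap k A (χ a) = GradedAlgebra.proj 𝒜 0 a) {n i : ℕ} {a : A}
    (ha : a ∈ augFiltration χ n) (ha' : a ∈ 𝒜 i) (hi : i < n) : a = 0 := by
  have := proj_eq_zero_of_mem_augFiltration hχ ha hi
  rwa [proj_of_mem ha', if_pos rfl] at this

lemma lieWords_le_leadingPrimitives [Nontrivial A]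
    (hχ : ∀ a, algebraMap k A (χ a) = GradedAlgebra.proj 𝒜 0 a) {D : A →ₐ[k] A ⊗[k] A}
    (hD : ∀ a, χ a = 0 → D a - (a ⊗ₜ[k] 1 + 1 ⊗ₜ[k] a) ∈
      Submodule.span k {z | ∃ x y, χ x = 0 ∧ χ y = 0 ∧ x ⊗ₜ[k] y = z})
    (j w : ℕ) : lieWords 𝒜 j w ≤ leadingPrimitives χ D j := by
  have h1 : ∀ w, 0 < w → 𝒜 w ≤ leadingPrimitives χ D 1 := by
    intro w hw a ha
    have ha' := homogeneous_le_augFiltration_one hχ hw ha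
    refine mem_leadingPrimitives.2 ⟨ha', comul_sub_mem_tensorFiltration hD ?_⟩
    rw [augFiltration_one] at ha'
    exact ha'
  induction j using Nat.strong_induction_on generalizing w with
  | _ j ih =>
  match j, ih with
  | 0, _ => rw [lieWords_zero]; exact bot_le
  | 1, _ =>
    rw [lieWords]
    split_ifs with h
    · exact bot_le
    · exact h1 w (by omega)
  | j + 2, ih =>
    rw [lieWords, Submodule.span_le]
    rintro _ ⟨a, b, ha, rfl, x, hx, y, hy, rfl⟩
    have := commutator_mem_leadingPrimitives (h1 a ha hx) (ih (j + 1) (by omega) b hy)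
    rwa [show 1 + (j + 1) = j + 2 by omega] at this

lemma lieWords_le_augFiltration [Nontrivial A]
    (hχ : ∀ a, algebraMap k A (χ a) = GradedAlgebra.proj 𝒜 0 a) (j w : ℕ) :
    lieWords 𝒜 j w ≤ augFiltration χ j := by
  induction j using Nat.strong_induction_on generalizing w with
  | _ j ih =>
  match j, ih with
  | 0, _ => rw [lieWords_zero]; exact bot_le
  | 1, _ =>
    rw [lieWords]
    split_ifs with h
    · exact bot_le
    · exact homogeneous_le_augFiltration_one hχ (by omega)
  | j + 2, ih =>
    rw [lieWords, Submodule.span_le]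
    rintro _ ⟨a, b, ha, rfl, x, hx, y, hy, rfl⟩
    have hx' := homogeneous_le_augFiltration_one hχ ha hx
    have hy' := ih (j + 1) (by omega) b hy
    refine sub_mem ?_ ?_
    · rw [show j + 2 = 1 + (j + 1) by omega, ← augFiltration_mul]
      exact Submodule.mul_mem_mul hx' hy'
    · rw [show j + 2 = (j + 1) + 1 by omega, ← augFiltration_mul]
      exact Submodule.mul_mem_mul hy' hx'

/-- Each factor has degree at least one, so the degree is at least the length. -/
lemma lieWords_eq_bot_of_lt [Nontrivial A]
    (hχ : ∀ a, algebraMap k A (χ a) = GradedAlgebra.proj 𝒜 0 a) {j w : ℕ} (h : w < j) :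
    lieWords 𝒜 j w = ⊥ :=
  (Submodule.eq_bot_iff _).2 fun _ ha => eq_zero_of_mem_augFiltration hχ
    (lieWords_le_augFiltration hχ j w ha) (lieWords_le 𝒜 j w ha) h

end Graded

/-! ### Choosing homogeneous Lie generators -/

section Generators

variable {k : Type*} {A : Type*} [Field k] [Ring A] [Algebra k A]

/-- A family of homogeneous Lie words that is a basis, to leading order, of all Lie words. -/
structure LieGenerators (𝒜 : ℕ → Submodule k A) (χ : A →ₐ[k] k) (S : Type) where
  /-- The number of factors of a generator. -/
  len : S → ℕ
  /-- The degree of a generator. -/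
  deg : S → ℕ
  /-- The generators. -/
  gen : S → A
  gen_mem : ∀ s, gen s ∈ lieWords 𝒜 (len s) (deg s)
  lieWords_le : ∀ j w, lieWords 𝒜 j w ≤
    Submodule.span k (gen '' {s | len s = j ∧ deg s = w}) ⊔ augFiltration χ (j + 1)
  linearIndepOn : ∀ n, LinearIndepOn k ((augFiltration χ (n + 1)).mkQ ∘ gen) {s | len s = n}
  len_pos : ∀ s, 0 < len s
  len_le_deg : ∀ s, len s ≤ deg s
  finite_deg : ∀ w, {s | deg s = w}.Finite

lemma linearIndepOn_mkQ_of_exists_dual {M ι : Type*} [AddCommGroup M] [Module k M]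
    {N : Submodule k M} {v : ι → M} {T : Set ι}
    (h : ∀ i ∈ T, ∃ f : M →ₗ[k] k, (∀ y ∈ N, f y = 0) ∧ f (v i) = 1 ∧
      ∀ j ∈ T, j ≠ i → f (v j) = 0) :
    LinearIndepOn k (N.mkQ ∘ v) T := by
  rw [linearIndepOn_iff]
  intro c hc hsum
  rw [← Finsupp.apply_linearCombination, Submodule.mkQ_apply, Submodule.Quotient.mk_eq_zero] at hsum
  ext i
  by_contra hi
  have hmem : i ∈ T := hc (Finsupp.mem_support_iff.2 hi)
  obtain ⟨f, hf, hf1, hf0⟩ := h i hmem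
  have hz := hf _ hsum
  rw [Finsupp.linearCombination_apply, Finsupp.sum, map_sum, Finset.sum_eq_single i] at hz
  · rw [map_smul, hf1, smul_eq_mul, mul_one] at hz
    exact hi hz
  · intro j hj hji
    rw [map_smul, hf0 j (hc hj) hji, smul_zero]
  · intro hn
    exact absurd (Finsupp.mem_support_iff.2 hi) hn

/-- For each length `j` and degree `w`, a finite basis of the Lie words modulo `F (j + 1)` is
lifted. Independence across degrees holds because the filtration is stable under the homogeneous
projections. -/
theorem exists_lieGenerators [Nontrivial A] (𝒜 : ℕ → Submodule k A) [GradedAlgebra 𝒜]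
    (hfin : IsLocallyFinite 𝒜) {χ : A →ₐ[k] k}
    (hχ : ∀ a, algebraMap k A (χ a) = GradedAlgebra.proj 𝒜 0 a) :
    ∃ S : Type, Nonempty (LieGenerators 𝒜 χ S) := by
  let W : ∀ p : ℕ × ℕ, Submodule k (A ⧸ augFiltration χ (p.1 + 1)) := fun p =>
    (lieWords 𝒜 p.1 p.2).map (augFiltration χ (p.1 + 1)).mkQ
  have hW : ∀ p, Module.Finite k (W p) := by
    intro p
    have := hfin p.2
    have : Module.Finite k (lieWords 𝒜 p.1 p.2) :=
      Submodule.finiteDimensional_of_le (lieWords_le 𝒜 p.1 p.2)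
    infer_instance
  let b : ∀ p, Module.Basis (Fin (Module.finrank k (W p))) k (W p) := fun p =>
    Module.finBasis k (W p)
  have hlift : ∀ s : (Σ p : ℕ × ℕ, Fin (Module.finrank k (W p))),
      ∃ a ∈ lieWords 𝒜 s.1.1 s.1.2,
        (augFiltration χ (s.1.1 + 1)).mkQ a = (b s.1 s.2 : A ⧸ augFiltration χ (s.1.1 + 1)) :=
    fun s => Submodule.mem_map.1 (b s.1 s.2).2
  choose x hx hxb using hlift
  have hne : ∀ s : (Σ p : ℕ × ℕ, Fin (Module.finrank k (W p))), x s ≠ 0 := by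
    intro s h0
    have := hxb s
    rw [h0, map_zero] at this
    exact (b s.1).ne_zero s.2 (Subtype.ext this.symm)
  have hle : ∀ s : (Σ p : ℕ × ℕ, Fin (Module.finrank k (W p))), s.1.1 ≤ s.1.2 := by
    intro s
    by_contra h
    have h2 := hx s
    rw [lieWords_eq_bot_of_lt hχ (by omega), Submodule.mem_bot] at h2
    exact hne s h2
  refine ⟨Σ p : ℕ × ℕ, Fin (Module.finrank k (W p)), ⟨⟨fun s => s.1.1, fun s => s.1.2, x, hx,
    ?_, ?_, ?_, hle, ?_⟩⟩⟩
  · intro j w a ha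
    have h1 : (⟨(augFiltration χ (j + 1)).mkQ a, Submodule.mem_map_of_mem ha⟩ : W (j, w)) ∈
        Submodule.span k (Set.range (b (j, w))) := by
      rw [(b (j, w)).span_eq]; trivial
    have h2 := Submodule.mem_map_of_mem (f := (W (j, w)).subtype) h1
    rw [Submodule.map_span] at h2
    have h3 : (augFiltration χ (j + 1)).mkQ a ∈ (Submodule.span k
        (x '' {s | s.1.1 = j ∧ s.1.2 = w})).map (augFiltration χ (j + 1)).mkQ := by
      rw [Submodule.map_span]
      refine Submodule.span_mono ?_ h2
      rintro _ ⟨_, ⟨i, rfl⟩, rfl⟩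
      exact ⟨x ⟨(j, w), i⟩, ⟨⟨(j, w), i⟩, ⟨rfl, rfl⟩, rfl⟩, hxb ⟨(j, w), i⟩⟩
    obtain ⟨y, hy, hya⟩ := h3
    rw [← add_sub_cancel y a]
    refine Submodule.add_mem_sup hy ?_
    rw [← Submodule.ker_mkQ (augFiltration χ (j + 1)), LinearMap.mem_ker, map_sub, hya, sub_self]
  · intro n
    refine linearIndepOn_mkQ_of_exists_dual ?_
    rintro ⟨⟨j, w⟩, i⟩ hj
    obtain rfl : j = n := hj
    obtain ⟨g, hg⟩ := LinearMap.exists_extend ((b (j, w)).coord i)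
    have hgb : ∀ i', g ((augFiltration χ (j + 1)).mkQ (x ⟨(j, w), i'⟩)) =
        if i' = i then 1 else 0 := by
      intro i'
      rw [hxb ⟨(j, w), i'⟩]
      have := LinearMap.congr_fun hg (b (j, w) i')
      rw [LinearMap.comp_apply, Submodule.subtype_apply] at this
      rw [this, Module.Basis.coord_apply, Module.Basis.repr_self, Finsupp.single_apply]
    -- Projecting to degree `w` first kills the generators of other degrees, and preserves `F (j +
    -- 1)`.
    refine ⟨g ∘ₗ (augFiltration χ (j + 1)).mkQ ∘ₗ GradedAlgebra.proj 𝒜 w, ?_, ?_, ?_⟩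
    · intro y hy
      have := proj_mem_augFiltration hχ hy w
      rw [LinearMap.comp_apply, LinearMap.comp_apply, Submodule.mkQ_apply,
        (Submodule.Quotient.mk_eq_zero _).2 this, map_zero]
    · rw [LinearMap.comp_apply, LinearMap.comp_apply, proj_of_mem (lieWords_le 𝒜 _ _ (hx _)),
        if_pos rfl, hgb, if_pos rfl]
    · rintro ⟨⟨j', w'⟩, i'⟩ hj' hne'
      obtain rfl : j' = j := hj'
      rw [LinearMap.comp_apply, LinearMap.comp_apply, proj_of_mem (lieWords_le 𝒜 _ _ (hx _))]
      by_cases hw : w' = w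
      · subst hw
        rw [if_pos rfl, hgb, if_neg]
        rintro rfl
        exact hne' rfl
      · rw [if_neg hw, map_zero, map_zero]
  · intro s
    by_contra h
    have h2 := hx s
    have h3 : s.1.1 = 0 := by omega
    rw [h3, lieWords_zero, Submodule.mem_bot] at h2
    exact hne s h2
  · intro w
    refine Set.Finite.subset ((Set.finite_Iic w).biUnion (t := fun j =>
      Set.range fun i : Fin (Module.finrank k (W (j, w))) =>
        (⟨(j, w), i⟩ : Σ p : ℕ × ℕ, Fin (Module.finrank k (W p))))
      (fun j _ => Set.finite_range _)) ?_
    rintro ⟨⟨j, v⟩, i⟩ hv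
    obtain rfl : v = w := hv
    exact Set.mem_biUnion (hle ⟨(j, v), i⟩) ⟨i, rfl⟩

end Generators

end GradedHopf

namespace GradedHopf

open TensorProduct

/-! ### The ordered monomials form a homogeneous basis -/

section Basis

variable {k : Type*} {A : Type*} [Field k] [Ring A] [Algebra k A]
  {𝒜 : ℕ → Submodule k A} {χ : A →ₐ[k] k} {S : Type}

namespace LieGenerators

variable (G : LieGenerators 𝒜 χ S)

lemma deg_pos (s : S) : 0 < G.deg s := (G.len_pos s).trans_le (G.len_le_deg s)

lemma lieWords_le_span_len (j w : ℕ) : lieWords 𝒜 j w ≤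
    Submodule.span k (G.gen '' {s | G.len s = j}) ⊔ augFiltration χ (j + 1) :=
  (G.lieWords_le j w).trans
    (sup_le_sup_right (Submodule.span_mono (Set.image_mono fun _ hu => hu.1)) _)

variable [GradedAlgebra 𝒜]

lemma gen_mem_homogeneous (s : S) : G.gen s ∈ 𝒜 (G.deg s) :=
  GradedHopf.lieWords_le 𝒜 _ _ (G.gen_mem s)

variable [LinearOrder S]

lemma orderedMonomial_mem_homogeneous (α : Multiset S) :
    orderedMonomial G.gen α ∈ 𝒜 (α.map G.deg).sum := by
  refine orderedMonomial_mem SetLike.GradedOne.one_mem (fun i j => ?_) G.gen_mem_homogeneous α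
  exact Submodule.mul_le.2 fun a ha b hb => SetLike.mul_mem_graded ha hb

/-- The ordered monomials in the generators are linearly independent. -/
theorem linearIndependent_orderedMonomial [Nontrivial A] [CharZero k]
    (hχ : ∀ a, algebraMap k A (χ a) = GradedAlgebra.proj 𝒜 0 a) {D : A →ₐ[k] A ⊗[k] A}
    (hD : ∀ a, χ a = 0 → D a - (a ⊗ₜ[k] 1 + 1 ⊗ₜ[k] a) ∈
      Submodule.span k {z | ∃ x y, χ x = 0 ∧ χ y = 0 ∧ x ⊗ₜ[k] y = z}) :
    LinearIndependent k (orderedMonomial G.gen) := by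
  have h0 : (1 : A) ∈ augFiltration χ 0 := by rw [augFiltration_zero]; trivial
  have hmul : ∀ i j, augFiltration χ i * augFiltration χ j ≤ augFiltration χ (i + j) :=
    fun i j => (augFiltration_mul χ i j).le
  have hx : ∀ s, G.gen s ∈ leadingPrimitives χ D (G.len s) :=
    fun s => lieWords_le_leadingPrimitives hχ hD _ _ (G.gen_mem s)
  have hx1 : ∀ s, G.gen s ∈ augFiltration χ (G.len s) :=
    fun s => (mem_leadingPrimitives.1 (hx s)).1
  have key := linearIndepOn_orderedMonomial h0 hmul (augFiltration_antitone χ)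
    (one_notMem_augFiltration_one χ) G.len_pos hx1 (comul_mem_tensorFiltration hD)
    (fun s => (mem_leadingPrimitives.1 (hx s)).2) G.linearIndepOn
  rw [linearIndependent_iff]
  intro c hc
  by_contra hne
  -- In a linear relation, the monomials of minimal total length already violate independence to
  -- leading order.
  obtain ⟨α, hα, hmin⟩ := Finset.exists_min_image c.support (fun α => (α.map G.len).sum)
    (Finsupp.support_nonempty_iff.2 hne)
  obtain ⟨f, hf, hf1, hf0⟩ := exists_dual_of_linearIndepOn_mkQ (key (α.map G.len).sum)
    (i := α) rfl
  have hz : f (Finsupp.linearCombination k (orderedMonomial G.gen) c) = 0 := by rw [hc, map_zero]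
  rw [Finsupp.linearCombination_apply, Finsupp.sum, map_sum, Finset.sum_eq_single α] at hz
  · rw [map_smul, hf1, smul_eq_mul, mul_one] at hz
    exact Finsupp.mem_support_iff.1 hα hz
  · intro β hβ hβα
    rw [map_smul]
    rcases (hmin β hβ).eq_or_lt with h | h
    · rw [hf0 β h.symm hβα, smul_zero]
    · rw [hf _ (augFiltration_antitone χ h (orderedMonomial_mem h0 hmul hx1 β)), smul_zero]
  · exact fun h => absurd hα h

/-- Homogeneous elements of positive degree are Lie words of length one, so to leading order `F 1`
is spanned by generators of length one. Multiplying by one more of these and sorting gives the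
induction step. -/
lemma augFiltration_le_span_orderedMonomial [Nontrivial A]
    (hχ : ∀ a, algebraMap k A (χ a) = GradedAlgebra.proj 𝒜 0 a) (n : ℕ) :
    augFiltration χ n ≤
      Submodule.span k (orderedMonomial G.gen '' {α | (α.map G.len).sum = n}) ⊔
        augFiltration χ (n + 1) := by
  have hmul : ∀ {i j : ℕ} {a b : A}, a ∈ augFiltration χ i → b ∈ augFiltration χ j →
      a * b ∈ augFiltration χ (i + j) := fun ha hb =>
    (augFiltration_mul χ _ _).le (Submodule.mul_mem_mul ha hb)
  have hx : ∀ s, G.gen s ∈ augFiltration χ (G.len s) :=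
    fun s => lieWords_le_augFiltration hχ _ _ (G.gen_mem s)
  have hword : ∀ l : List S, (l.map G.gen).prod ∈ Submodule.span k
      (orderedMonomial G.gen '' {α | (α.map G.len).sum = (l.map G.len).sum}) ⊔
        augFiltration χ ((l.map G.len).sum + 1) := by
    refine word_mem_span_orderedMonomial (fun s n y hy => hmul (hx s) hy)
      (fun s n y hy => hmul hy (hx s)) fun s t => ?_
    exact G.lieWords_le_span_len _ _ (commutator_mem_lieWords (G.gen_mem s) (G.gen_mem t))
  have h1 : augFiltration χ 1 ≤
      Submodule.span k (G.gen '' {s | G.len s = 1}) ⊔ augFiltration χ 2 := by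
    refine (augFiltration_le_span hχ 1).trans (Submodule.span_le.2 ?_)
    rintro y ⟨i, hi, hy, _⟩
    rw [← lieWords_one 𝒜 hi] at hy
    exact G.lieWords_le_span_len _ _ hy
  induction n with
  | zero =>
    intro a _
    rw [← add_sub_cancel (algebraMap k A (χ a)) a]
    refine Submodule.add_mem_sup ?_ ?_
    · rw [Algebra.algebraMap_eq_smul_one]
      exact Submodule.smul_mem _ _ (Submodule.subset_span ⟨0, by simp, by simp⟩)
    · rw [zero_add, augFiltration_one]
      simp
  | succ n ih =>
    rw [← augFiltration_mul χ n 1, Submodule.mul_le]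
    intro y hy z hz
    obtain ⟨p, hp, p', hp', rfl⟩ := Submodule.mem_sup.1 (ih hy)
    obtain ⟨q, hq, q', hq', rfl⟩ := Submodule.mem_sup.1 (h1 hz)
    have hq1 : q ∈ augFiltration χ 1 := by
      refine Submodule.span_le.2 ?_ hq
      rintro _ ⟨s, hs, rfl⟩
      have h := hx s
      rwa [show G.len s = 1 from hs] at h
    rw [mul_add, add_mul]
    refine add_mem (add_mem ?_ (Submodule.mem_sup_right ?_)) (Submodule.mem_sup_right ?_)
    · have hpq := Submodule.mul_mem_mul hp hq
      rw [Submodule.span_mul_span] at hpq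
      refine Submodule.span_le.2 ?_ hpq
      rintro _ ⟨_, ⟨α, hα, rfl⟩, _, ⟨s, hs, rfl⟩, rfl⟩
      have h2 := hword (α.sort (· ≤ ·) ++ [s])
      have h3 : ((α.sort (· ≤ ·)).map G.len).sum = n := by
        rw [← show (α.map G.len).sum = n from hα, ← Multiset.sum_coe, ← Multiset.map_coe,
          Multiset.sort_eq]
      simp only [List.map_append, List.prod_append, List.sum_append, h3] at h2
      simpa [show G.len s = 1 from hs, orderedMonomial] using h2
    · exact hmul hp' hq1
    · exact hmul (i := n) (j := 2) hy hq'

/-- The ordered monomials of degree `w` span the component of degree `w`. -/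
theorem span_orderedMonomial [Nontrivial A]
    (hχ : ∀ a, algebraMap k A (χ a) = GradedAlgebra.proj 𝒜 0 a)
    (w : ℕ) :
    Submodule.span k (orderedMonomial G.gen '' {α | (α.map G.deg).sum = w}) = 𝒜 w := by
  refine le_antisymm (Submodule.span_le.2 ?_) fun a ha => ?_
  · rintro _ ⟨α, rfl, rfl⟩
    exact G.orderedMonomial_mem_homogeneous α
  · have key : ∀ n, (⊤ : Submodule k A) ≤
        Submodule.span k (Set.range (orderedMonomial G.gen)) ⊔ augFiltration χ n := by
      intro n
      induction n with
      | zero => rw [augFiltration_zero]; exact le_sup_right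
      | succ n ih =>
        refine ih.trans (sup_le le_sup_left ((G.augFiltration_le_span_orderedMonomial hχ n).trans
          (sup_le_sup_right (Submodule.span_mono (Set.image_subset_range _ _)) _)))
    -- `F (w + 1)` has no component in degree `w`, so the remainder disappears under the projection.
    obtain ⟨p, hp, q, hq, hpq⟩ := Submodule.mem_sup.1 (key (w + 1) (Submodule.mem_top (x := a)))
    have ha' : a = GradedAlgebra.proj 𝒜 w p := by
      have h := congrArg (GradedAlgebra.proj 𝒜 w) hpq
      rw [map_add, proj_eq_zero_of_mem_augFiltration hχ hq (Nat.lt_succ_self w), add_zero,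
        proj_of_mem ha, if_pos rfl] at h
      exact h.symm
    rw [ha']
    refine (Submodule.span_le.2 ?_ : _ ≤ (Submodule.span k
      (orderedMonomial G.gen '' {α | (α.map G.deg).sum = w})).comap (GradedAlgebra.proj 𝒜 w)) hp
    rintro _ ⟨α, rfl⟩
    rw [SetLike.mem_coe, Submodule.mem_comap, proj_of_mem (G.orderedMonomial_mem_homogeneous α)]
    split_ifs with h
    · exact Submodule.subset_span ⟨α, h, rfl⟩
    · exact zero_mem _

end LieGenerators

end Basis

end GradedHopf

namespace GradedHopf

open Filter PowerSeries
open scoped PowerSeries.WithPiTopology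

/-! ### Infinite products of power series and uniqueness of exponents -/

section InverseProduct

lemma X_pow_dvd_one_sub_X_pow_pow_sub (N a : ℕ) (hN : 0 < N) :
    (X : ℤ⟦X⟧) ^ (N + 1) ∣ (1 - X ^ N) ^ a - (1 - (a : ℤ⟦X⟧) * X ^ N) := by
  induction a with
  | zero => simp
  | succ a ih =>
    have e : ((1 : ℤ⟦X⟧) - X ^ N) ^ (a + 1) - (1 - (Nat.cast (a + 1) : ℤ⟦X⟧) * X ^ N) =
        ((1 - X ^ N) ^ a - (1 - (a : ℤ⟦X⟧) * X ^ N)) * (1 - X ^ N) +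
          X ^ (N + 1) * ((a : ℤ⟦X⟧) * X ^ (N - 1)) := by
      have : (X : ℤ⟦X⟧) ^ (N + 1) * ((a : ℤ⟦X⟧) * X ^ (N - 1)) = (a : ℤ⟦X⟧) * X ^ N * X ^ N := by
        obtain ⟨M, rfl⟩ : ∃ M, N = M + 1 := ⟨N - 1, by omega⟩
        rw [Nat.add_sub_cancel]
        ring
      rw [this]
      push_cast
      ring
    rw [e]
    exact dvd_add (ih.mul_right _) (dvd_mul_right _ _)

lemma X_pow_dvd_pow_sub_one (N i a : ℕ) (h : N ≤ i) :
    (X : ℤ⟦X⟧) ^ N ∣ (1 - X ^ i) ^ a - 1 := by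
  have h1 : (1 : ℤ⟦X⟧) - X ^ i - 1 ∣ (1 - X ^ i) ^ a - 1 ^ a := sub_dvd_pow_sub_pow _ _ _
  rw [one_pow] at h1
  refine dvd_trans ?_ h1
  rw [sub_sub_cancel_left, dvd_neg]
  exact pow_dvd_pow _ h

/-- The partial products of `∏ (1 - t ^ i) ^ (n i)`. -/
noncomputable def partialProd (n : ℕ+ → ℕ) (N : ℕ) : ℤ⟦X⟧ :=
  ∏ i ∈ Finset.range N, (1 - X ^ (i + 1)) ^ n i.succPNat

lemma partialProd_succ (n : ℕ+ → ℕ) (N : ℕ) :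
    partialProd n (N + 1) = partialProd n N * (1 - X ^ (N + 1)) ^ n N.succPNat :=
  Finset.prod_range_succ _ _

lemma X_pow_dvd_prod_sub_partialProd (n : ℕ+ → ℕ) (N : ℕ) (T : Finset ℕ+)
    (hT : (Finset.range N).map ⟨Nat.succPNat, Nat.succPNat_injective⟩ ⊆ T) :
    (X : ℤ⟦X⟧) ^ (N + 1) ∣ ∏ i ∈ T, (1 - X ^ (i : ℕ)) ^ n i - partialProd n N := by
  have h1 : partialProd n N = ∏ i ∈ (Finset.range N).map ⟨Nat.succPNat, Nat.succPNat_injective⟩,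
      (1 - X ^ (i : ℕ)) ^ n i := by
    rw [Finset.prod_map]; rfl
  rw [← Finset.prod_sdiff hT, ← h1, ← sub_one_mul]
  refine Dvd.dvd.mul_right ?_ _
  have h2 : ∀ i ∈ T \ (Finset.range N).map ⟨Nat.succPNat, Nat.succPNat_injective⟩,
      N + 1 ≤ (i : ℕ) := by
    intro i hi
    by_contra h
    refine (Finset.mem_sdiff.1 hi).2 (Finset.mem_map.2 ⟨i.natPred, ?_, ?_⟩)
    · rw [Finset.mem_range]
      have := i.natPred_add_one
      omega
    · simp
  revert h2
  generalize T \ (Finset.range N).map ⟨Nat.succPNat, Nat.succPNat_injective⟩ = T'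
  induction T' using Finset.induction_on with
  | empty => simp
  | insert i T' hi ih =>
    intro h2
    rw [Finset.prod_insert hi]
    have e : ∀ a b : ℤ⟦X⟧, a * b - 1 = (a - 1) * b + (b - 1) := fun a b => by ring
    rw [e]
    exact dvd_add (Dvd.dvd.mul_right (X_pow_dvd_pow_sub_one _ _ _
      (h2 i (Finset.mem_insert_self _ _))) _)
      (ih fun j hj => h2 j (Finset.mem_insert_of_mem hj))

/-- Coefficients are discrete, and factors of index above `N` are `1` modulo `X ^ (N + 1)`; so
convergence means agreement with each partial product up to degree `N`. -/
lemma hasProd_iff_X_pow_dvd (n : ℕ+ → ℕ) (P : ℤ⟦X⟧) :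
    HasProd (fun i : ℕ+ => (1 - (X : ℤ⟦X⟧) ^ (i : ℕ)) ^ n i) P ↔
      ∀ N, X ^ (N + 1) ∣ P - partialProd n N := by
  have hT : ∀ N, ∀ᶠ T : Finset ℕ+ in atTop,
      (X : ℤ⟦X⟧) ^ (N + 1) ∣ ∏ i ∈ T, (1 - X ^ (i : ℕ)) ^ n i - partialProd n N := fun N =>
    eventually_atTop.2 ⟨_, fun T hT => X_pow_dvd_prod_sub_partialProd n N T hT⟩
  have hP : HasProd (fun i : ℕ+ => (1 - (X : ℤ⟦X⟧) ^ (i : ℕ)) ^ n i) P ↔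
      ∀ c, Tendsto (fun T : Finset ℕ+ => coeff c (∏ i ∈ T, (1 - (X : ℤ⟦X⟧) ^ (i : ℕ)) ^ n i))
        atTop (nhds (coeff c P)) := by
    rw [HasProd, SummationFilter.unconditional_filter,
      PowerSeries.WithPiTopology.tendsto_iff_coeff_tendsto]
  rw [hP]
  constructor
  · intro h N
    rw [X_pow_dvd_iff]
    intro c hc
    have h1 : Tendsto (fun T : Finset ℕ+ => coeff c (∏ i ∈ T, (1 - (X : ℤ⟦X⟧) ^ (i : ℕ)) ^ n i))
        atTop (nhds (coeff c (partialProd n N))) := by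
      refine tendsto_const_nhds.congr' ?_
      filter_upwards [hT N] with T hT
      have := X_pow_dvd_iff.1 hT c hc
      rw [map_sub, sub_eq_zero] at this
      exact this.symm
    rw [map_sub, tendsto_nhds_unique (h c) h1, sub_self]
  · intro h c
    refine tendsto_const_nhds.congr' ?_
    filter_upwards [hT c] with T hT
    have h1 := X_pow_dvd_iff.1 hT c (Nat.lt_succ_self c)
    have h2 := X_pow_dvd_iff.1 (h c) c (Nat.lt_succ_self c)
    rw [map_sub, sub_eq_zero] at h1 h2
    rw [h1, h2]

lemma isInverseProduct_iff (h : ℤ⟦X⟧) (n : ℕ+ → ℕ) :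
    IsInverseProduct h n ↔ ∀ N, X ^ (N + 1) ∣ h * partialProd n N - 1 := by
  constructor
  · rintro ⟨P, hP, hhP⟩ N
    have h1 := (hasProd_iff_X_pow_dvd n P).1 hP N
    rw [← hhP, ← mul_sub, ← dvd_neg, ← mul_neg, neg_sub]
    exact h1.mul_left _
  · intro hN
    -- For `N = 0` the partial product is empty, so `h` has constant term one and is invertible.
    have h0 : constantCoeff h = ((1 : ℤˣ) : ℤ) := by
      have := X_pow_dvd_iff.1 (hN 0) 0 (by norm_num)
      rw [map_sub, sub_eq_zero] at this
      simpa [partialProd] using this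
    have hinv := mul_invOfUnit h 1 h0
    refine ⟨invOfUnit h 1, (hasProd_iff_X_pow_dvd n _).2 fun N => ?_, hinv⟩
    have e : invOfUnit h 1 - partialProd n N =
        - (invOfUnit h 1 * (h * partialProd n N - 1)) := by
      linear_combination (partialProd n N) * hinv
    rw [e, dvd_neg]
    exact (hN N).mul_left _

theorem IsInverseProduct.unique {h : ℤ⟦X⟧} {m n : ℕ+ → ℕ} (hm : IsInverseProduct h m)
    (hn : IsInverseProduct h n) : m = n := by
  rw [isInverseProduct_iff] at hm hn
  have key : ∀ N : ℕ, ∀ i : ℕ, i < N → m i.succPNat = n i.succPNat := by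
    intro N
    induction N with
    | zero => simp
    | succ N ih =>
      intro i hi
      rcases Nat.lt_succ_iff_lt_or_eq.1 hi with hi | rfl
      · exact ih i hi
      · have hpp : partialProd m i = partialProd n i :=
          Finset.prod_congr rfl fun j hj => by rw [ih j (Finset.mem_range.1 hj)]
        have hmi := hm (i + 1)
        have hni := hn (i + 1)
        rw [partialProd_succ, ← mul_assoc] at hmi hni
        rw [hpp] at hmi
        have h0 : constantCoeff (h * partialProd n i) = 1 := by
          have := X_pow_dvd_iff.1 (hn i) 0 (by omega)
          rw [map_sub, sub_eq_zero] at this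
          simpa using this
        set u := h * partialProd n i
        -- Once the first `i` factors agree, the coefficient of `X ^ (i + 1)` in `u` must cancel the
        -- term `-a X ^ (i + 1)` of the next factor, so it determines `a`.
        have hc : ∀ a : ℕ, (X : ℤ⟦X⟧) ^ (i + 1 + 1) ∣ u * (1 - X ^ (i + 1)) ^ a - 1 →
            coeff (i + 1) u = a := by
          intro a ha
          have h1 := (X_pow_dvd_one_sub_X_pow_pow_sub (i + 1) a (by omega)).mul_left u
          have h2 := dvd_sub ha h1
          have e : u * (1 - X ^ (i + 1)) ^ a - 1 -
              u * ((1 - X ^ (i + 1)) ^ a - (1 - (a : ℤ⟦X⟧) * X ^ (i + 1))) =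
              u - (C (a : ℤ) * u) * X ^ (i + 1) - 1 := by
            have : C (a : ℤ) = (a : ℤ⟦X⟧) := by simp
            rw [this]; ring
          rw [e] at h2
          have h3 := X_pow_dvd_iff.1 h2 (i + 1) (Nat.lt_succ_self _)
          rw [map_sub, map_sub, coeff_mul_X_pow'] at h3
          simp [h0, coeff_one] at h3
          linarith
        exact_mod_cast (hc _ hmi).symm.trans (hc _ hni)
  funext i
  have := key (i.natPred + 1) i.natPred (Nat.lt_succ_self _)
  simpa using this

end InverseProduct

/-! ### Counting multisets by weight -/

section MultisetCount

variable {S : Type*} (d : S → ℕ)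

/-- The multisets of weight `w` with elements in `U`. -/
def weightedMultisets (U : Set S) (w : ℕ) : Set (Multiset S) :=
  {α | (∀ s ∈ α, s ∈ U) ∧ (α.map d).sum = w}

/-- The generating function that counts the multisets with elements in `U` by weight. -/
noncomputable def multisetSeries (U : Set S) : ℤ⟦X⟧ :=
  PowerSeries.mk fun w => ((weightedMultisets d U w).ncard : ℤ)

variable {d}

lemma card_le_sum_map (hd : ∀ s, 0 < d s) (α : Multiset S) : α.card ≤ (α.map d).sum := by
  have := Multiset.card_nsmul_le_sum (s := α.map d) (a := 1) (by
    intro x hx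
    obtain ⟨s, _, rfl⟩ := Multiset.mem_map.1 hx
    exact hd s)
  simpa using this

lemma finite_setOf_le (hfin : ∀ w, {s | d s = w}.Finite) (w : ℕ) : {s | d s ≤ w}.Finite := by
  refine ((Set.finite_Iic w).biUnion fun i _ => hfin i).subset fun s hs => ?_
  exact Set.mem_biUnion (show d s ∈ Set.Iic w from hs) rfl

lemma finite_weightedMultisets (hd : ∀ s, 0 < d s) (hfin : ∀ w, {s | d s = w}.Finite)
    (U : Set S) (w : ℕ) : (weightedMultisets d U w).Finite := by
  classical
  have hT := finite_setOf_le hfin w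
  -- Letters have weight at least one, so only those of weight at most `w` occur, each at most `w`
  -- times.
  refine (Set.finite_Iic (w • hT.toFinset.val)).subset fun α hα => ?_
  rw [Set.mem_Iic, Multiset.le_iff_count]
  intro s
  by_cases hs : s ∈ α
  · have h1 : d s ≤ w := hα.2 ▸ Multiset.single_le_sum (by simp) _ (Multiset.mem_map_of_mem d hs)
    rw [Multiset.count_nsmul, Multiset.count_eq_one_of_mem hT.toFinset.nodup (by simpa using h1)]
    have h2 := Multiset.count_le_card s α
    have h3 := card_le_sum_map hd α
    rw [hα.2] at h3
    simp only [mul_one]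
    omega
  · rw [Multiset.count_eq_zero_of_notMem hs]; exact Nat.zero_le _

/-- A multiset either avoids `s` or is uniquely `s ::ₘ β`, the latter contributing a factor `X ^ d
s`. -/
lemma multisetSeries_insert (hd : ∀ s, 0 < d s) (hfin : ∀ w, {s | d s = w}.Finite)
    {U : Set S} {s : S} (hs : s ∉ U) :
    multisetSeries d (insert s U) * (1 - X ^ d s) = multisetSeries d U := by
  classical
  have hf := finite_weightedMultisets hd hfin
  have key : ∀ w, (weightedMultisets d (insert s U) w).ncard =
      (weightedMultisets d U w).ncard +
        if d s ≤ w then (weightedMultisets d (insert s U) (w - d s)).ncard else 0 := by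
    intro w
    split_ifs with hw
    · have e : weightedMultisets d (insert s U) w = weightedMultisets d U w ∪
          (s ::ₘ ·) '' weightedMultisets d (insert s U) (w - d s) := by
        ext α
        constructor
        · rintro ⟨h1, h2⟩
          by_cases hsα : s ∈ α
          · obtain ⟨β, rfl⟩ := Multiset.exists_cons_of_mem hsα
            refine Or.inr ⟨β, ⟨fun t ht => h1 t (Multiset.mem_cons_of_mem ht), ?_⟩, rfl⟩
            rw [Multiset.map_cons, Multiset.sum_cons] at h2
            omega
          · refine Or.inl ⟨fun t ht => ?_, h2⟩
            rcases h1 t ht with rfl | h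
            · exact absurd ht hsα
            · exact h
        · rintro (⟨h1, h2⟩ | ⟨β, ⟨h1, h2⟩, rfl⟩)
          · exact ⟨fun t ht => Or.inr (h1 t ht), h2⟩
          · refine ⟨fun t ht => ?_, ?_⟩
            · rcases Multiset.mem_cons.1 ht with rfl | ht
              · exact Or.inl rfl
              · exact h1 t ht
            · simp only [Multiset.map_cons, Multiset.sum_cons]
              omega
      rw [e, Set.ncard_union_eq _ (hf _ _) ((hf _ _).image _),
        Set.ncard_image_of_injective _ (fun β γ h => (Multiset.cons_inj_right s).1 h)]
      rw [Set.disjoint_left]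
      rintro _ h1 ⟨β, _, rfl⟩
      exact hs (h1.1 s (Multiset.mem_cons_self s β))
    · congr 1
      ext α
      refine ⟨fun ⟨h1, h2⟩ => ⟨fun t ht => ?_, h2⟩, fun ⟨h1, h2⟩ => ⟨fun t ht => Or.inr (h1 t ht), h2⟩⟩
      rcases h1 t ht with rfl | h
      · exact absurd (h2 ▸ Multiset.single_le_sum (by simp) _ (Multiset.mem_map_of_mem d ht)) hw
      · exact h
  ext w
  rw [mul_sub, mul_one, map_sub, coeff_mul_X_pow']
  simp only [multisetSeries, coeff_mk]
  rw [key w]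
  split_ifs <;> simp

lemma multisetSeries_union (hd : ∀ s, 0 < d s) (hfin : ∀ w, {s | d s = w}.Finite)
    {U : Set S} {w : ℕ} (T : Finset S) (hT : ∀ s ∈ T, d s = w) (hU : ∀ s ∈ T, s ∉ U) :
    multisetSeries d (↑T ∪ U) * (1 - X ^ w) ^ T.card = multisetSeries d U := by
  classical
  induction T using Finset.induction_on with
  | empty => simp
  | insert s T hs ih =>
    have h1 := multisetSeries_insert hd hfin (U := ↑T ∪ U) (s := s) (by
      rintro (h | h)
      · exact hs h
      · exact hU s (Finset.mem_insert_self _ _) h)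
    rw [hT s (Finset.mem_insert_self _ _)] at h1
    rw [Finset.coe_insert, Set.insert_union, Finset.card_insert_of_notMem hs, pow_succ', ← mul_assoc,
      h1]
    exact ih (fun t ht => hT t (Finset.mem_insert_of_mem ht))
      fun t ht => hU t (Finset.mem_insert_of_mem ht)

/-- Multisets are counted by an infinite product. -/
theorem isInverseProduct_multisetSeries (hd : ∀ s, 0 < d s)
    (hfin : ∀ w, {s | d s = w}.Finite) :
    IsInverseProduct (multisetSeries d Set.univ) fun i => {s | d s = (i : ℕ)}.ncard := by
  rw [isInverseProduct_iff]
  -- Each factor removes the letters of its weight; with only weights above `N` left, the empty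
  -- multiset is alone in weights up to `N`.
  have key : ∀ N, multisetSeries d Set.univ *
      partialProd (fun i => {s | d s = (i : ℕ)}.ncard) N = multisetSeries d {s | N < d s} := by
    intro N
    induction N with
    | zero => simp [partialProd, hd]
    | succ N ih =>
      rw [partialProd_succ, ← mul_assoc, ih]
      have h := multisetSeries_union hd hfin (U := {s | N + 1 < d s}) (hfin (N + 1)).toFinset
        (w := N + 1) (by simp) (by
          intro s hs
          have : d s = N + 1 := by simpa using hs
          simp [this])
      rw [← Set.ncard_eq_toFinset_card _ (hfin (N + 1)), Set.Finite.coe_toFinset] at h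
      have e : {s | d s = N + 1} ∪ {s | N + 1 < d s} = {s | N < d s} := by
        ext s
        simp only [Set.mem_union, Set.mem_ofPred_eq]
        omega
      rw [e] at h
      exact h
  intro N
  rw [key, X_pow_dvd_iff]
  intro c hc
  have e : weightedMultisets d {s | N < d s} c = if c = 0 then {0} else ∅ := by
    ext α
    constructor
    · rintro ⟨h1, h2⟩
      have hα : α = 0 := by
        by_contra h
        obtain ⟨s, hs⟩ := Multiset.exists_mem_of_ne_zero h
        have h3 : d s ≤ c := h2 ▸ Multiset.single_le_sum (by simp) _ (Multiset.mem_map_of_mem d hs)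
        have h4 : N < d s := h1 s hs
        omega
      subst hα
      have : c = 0 := by simpa using h2.symm
      simp [this]
    · intro h
      split_ifs at h with hc0
      · rw [Set.mem_singleton_iff] at h
        subst h hc0
        exact ⟨by simp, by simp⟩
      · exact absurd h (Set.notMem_empty _)
  rw [map_sub, multisetSeries, coeff_mk, e, coeff_one]
  split_ifs <;> simp

end MultisetCount

end GradedHopf

namespace GradedHopf

open Filter

/-! ### Bounds on the Gelfand–Kirillov dimension -/

section Growth

variable {k : Type u} {A : Type v} [Field k] [Ring A] [Algebra k A]

/-- Constant factors in polynomial dimension bounds become `c / log n` and do not affect the limit.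
-/
lemma tendsto_add_div_log (d c : ℝ) :
    Tendsto (fun n : ℕ => ((d + c / Real.log n : ℝ) : EReal)) atTop (nhds (d : EReal)) := by
  rw [EReal.tendsto_coe]
  have h : Tendsto (fun n : ℕ => Real.log n) atTop atTop :=
    Real.tendsto_log_atTop.comp tendsto_natCast_atTop_atTop
  simpa using (tendsto_const_nhds (x := d)).add (h.const_div_atTop c)

lemma orderedMonomial_mem_pow {S : Type*} [LinearOrder S] (x : S → A) (V : Submodule k A)
    {α : Multiset S} (hα : ∀ s ∈ α, x s ∈ V) :
    orderedMonomial x α ∈ (1 ⊔ V) ^ α.card := by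
  induction α using orderedMonomial_induction with
  | zero => simpa using ⟨1, map_one _⟩
  | cons s α hs ih =>
    rw [orderedMonomial_cons x hs, Multiset.card_cons, pow_succ']
    exact Submodule.mul_mem_mul (Submodule.mem_sup_right (hα s (Multiset.mem_cons_self _ _)))
      (ih fun t ht => hα t (Multiset.mem_cons_of_mem ht))

/-- If the ordered monomials in the `x s` are linearly independent, then the Gelfand–Kirillov
dimension is at least the number of these elements. -/
theorem card_le_GKdim {S : Type*} [LinearOrder S] {x : S → A}
    (hli : LinearIndependent k (orderedMonomial x)) (T : Finset S) :
    ((T.card : ℝ) : EReal) ≤ GKdim k A := by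
  classical
  set m := T.card with hm
  let V : Submodule k A := Submodule.span k (x '' T)
  have hV : V.FG := Submodule.fg_span (T.finite_toSet.image x)
  refine le_trans ?_ (le_iSup (fun V : {V : Submodule k A // V.FG} =>
    limsup (fun n : ℕ => ((Real.log (Module.finrank k ↥((1 ⊔ V.1) ^ n)) / Real.log n : ℝ) : EReal))
      atTop) ⟨V, hV⟩)
  have hfg : ∀ n, Module.Finite k ↥((1 ⊔ V) ^ n) := fun n =>
    Module.Finite.iff_fg.2 ((Submodule.FG.sup
      (Submodule.one_eq_span (R := k) (A := A) ▸ Submodule.fg_span_singleton 1) hV).pow n)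
  have hcard : ∀ n : ℕ, (n / m + 1) ^ m ≤ Module.finrank k ↥((1 ⊔ V) ^ n) := by
    intro n
    -- Exponents up to `n / m` in each of the `m` elements give monomials of length at most `n`,
    -- hence a box of independent elements.
    let α : (T → Fin (n / m + 1)) → Multiset S := fun f => ∑ t : T, (f t : ℕ) • {(t : S)}
    have hcount : ∀ f (t : T), (α f).count (t : S) = f t := by
      intro f t
      simp only [α, Multiset.count_sum', Multiset.count_nsmul, Multiset.count_singleton]
      rw [Finset.sum_eq_single t]
      · simp
      · intro b _ hb
        rw [if_neg (fun h => hb (Subtype.ext h.symm)), mul_zero]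
      · simp
    have hinj : Function.Injective α := by
      intro f g hfg
      funext t
      apply Fin.ext
      rw [← hcount f t, hfg, hcount g t]
    have hmem : ∀ f, orderedMonomial x (α f) ∈ (1 ⊔ V) ^ n := by
      intro f
      have h1 : ∀ s ∈ α f, x s ∈ V := by
        intro s hs
        obtain ⟨t, _, ht⟩ := Multiset.mem_sum.1 hs
        have := Multiset.mem_singleton.1 (Multiset.mem_of_mem_nsmul ht)
        subst this
        exact Submodule.subset_span ⟨t, t.2, rfl⟩
      have h2 : (α f).card ≤ n := by
        simp only [α, Multiset.card_sum, Multiset.card_nsmul, Multiset.card_singleton, mul_one]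
        calc ∑ t : T, (f t : ℕ) ≤ ∑ _t : T, n / m :=
              Finset.sum_le_sum fun t _ => Nat.lt_succ_iff.1 (f t).2
          _ = m * (n / m) := by simp [hm]
          _ ≤ n := Nat.mul_div_le n m
      have h3 : (1 ⊔ V) ^ (α f).card ≤ (1 ⊔ V) ^ n := pow_le_pow_right' le_sup_left h2
      exact h3 (orderedMonomial_mem_pow x V h1)
    have hli' : LinearIndependent k
        (fun f => (⟨orderedMonomial x (α f), hmem f⟩ : ↥((1 ⊔ V) ^ n))) :=
      LinearIndependent.of_comp ((1 ⊔ V) ^ n).subtype (hli.comp α hinj)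
    have := hfg n
    have h := hli'.fintype_card_le_finrank
    simpa [hm] using h
  -- The constant comes from `log ((n / m) ^ m) = m log n - m log m`.
  rw [← (tendsto_add_div_log (m : ℝ) (-(m * Real.log m))).limsup_eq]
  refine limsup_le_limsup ?_
  filter_upwards [eventually_ge_atTop 2] with n hn
  rw [EReal.coe_le_coe_iff]
  have hlogn : 0 < Real.log n := Real.log_pos (by exact_mod_cast hn)
  rw [le_div_iff₀ hlogn, add_mul, div_mul_cancel₀ _ hlogn.ne']
  rcases Nat.eq_zero_or_pos m with h0 | hpos
  · rw [h0]
    simpa using Real.log_natCast_nonneg _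
  · have h1 : (n : ℝ) / m ≤ (n / m + 1 : ℕ) := by
      rw [div_le_iff₀ (by exact_mod_cast hpos)]
      have := Nat.lt_mul_div_succ n hpos
      rw [mul_comm]
      exact_mod_cast this.le
    have h2 : ((n : ℝ) / m) ^ m ≤ Module.finrank k ↥((1 ⊔ V) ^ n) := by
      refine (pow_le_pow_left₀ (by positivity) h1 m).trans ?_
      exact_mod_cast hcard n
    have hn0 : (0 : ℝ) < n := by positivity
    have hm0 : (0 : ℝ) < m := by exact_mod_cast hpos
    have h3 := Real.log_le_log (by positivity) h2
    rw [Real.log_pow, Real.log_div hn0.ne' hm0.ne'] at h3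
    linarith

variable {𝒜 : ℕ → Submodule k A}

variable (𝒜) in
/-- The sum of the components of degree at most `N`. -/
def truncation (N : ℕ) : Submodule k A := Submodule.span k {a | ∃ i ≤ N, a ∈ 𝒜 i}

lemma truncation_mono : Monotone (truncation 𝒜) := fun _ _ h =>
  Submodule.span_mono fun _ ⟨i, hi, ha⟩ => ⟨i, hi.trans h, ha⟩

variable [GradedAlgebra 𝒜]

lemma truncation_mul_le (m n : ℕ) : truncation 𝒜 m * truncation 𝒜 n ≤ truncation 𝒜 (m + n) := by
  rw [truncation, truncation, Submodule.span_mul_span, Submodule.span_le]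
  rintro _ ⟨a, ⟨i, hi, ha⟩, b, ⟨j, hj, hb⟩, rfl⟩
  exact Submodule.subset_span ⟨i + j, by omega, SetLike.mul_mem_graded ha hb⟩

lemma one_le_truncation (n : ℕ) : (1 : Submodule k A) ≤ truncation 𝒜 n :=
  Submodule.one_le.2 (Submodule.subset_span ⟨0, Nat.zero_le _, SetLike.GradedOne.one_mem⟩)

lemma truncation_pow_le (N n : ℕ) : truncation 𝒜 N ^ n ≤ truncation 𝒜 (n * N) := by
  induction n with
  | zero => rw [pow_zero]; exact one_le_truncation _
  | succ n ih =>
    rw [pow_succ, add_mul, one_mul]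
    exact (mul_le_mul' ih le_rfl).trans (truncation_mul_le _ _)

lemma exists_le_truncation {V : Submodule k A} (hV : V.FG) : ∃ N, V ≤ truncation 𝒜 N := by
  have h1 : ∀ a : A, ∃ N, a ∈ truncation 𝒜 N := by
    intro a
    induction a using DirectSum.Decomposition.inductionOn 𝒜 with
    | zero => exact ⟨0, zero_mem _⟩
    | @homogeneous i a => exact ⟨i, Submodule.subset_span ⟨i, le_rfl, a.2⟩⟩
    | add a b ha hb =>
      obtain ⟨m, hm⟩ := ha
      obtain ⟨n, hn⟩ := hb
      exact ⟨max m n, add_mem (truncation_mono (le_max_left _ _) hm)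
        (truncation_mono (le_max_right _ _) hn)⟩
  choose N hN using h1
  obtain ⟨T, rfl⟩ := hV
  exact ⟨T.sup N, Submodule.span_le.2 fun a ha => truncation_mono (Finset.le_sup ha) (hN a)⟩

/-- If the ordered monomials in finitely many homogeneous elements of positive degree span, then the
Gelfand–Kirillov dimension is at most the number of these elements. -/
theorem GKdim_le_card {S : Type*} [LinearOrder S] [Fintype S] {x : S → A} {d : S → ℕ}
    (hd : ∀ s, 0 < d s)
    (hspan : ∀ w, 𝒜 w ≤ Submodule.span k (orderedMonomial x '' {α | (α.map d).sum = w})) :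
    GKdim k A ≤ ((Fintype.card S : ℝ) : EReal) := by
  classical
  refine iSup_le fun ⟨V, hV⟩ => ?_
  obtain ⟨N, hN⟩ := exists_le_truncation (𝒜 := 𝒜) hV
  have hrank : ∀ n, Module.finrank k ↥((1 ⊔ V) ^ n) ≤ (n * N + 1) ^ Fintype.card S := by
    intro n
    have h1 : (1 ⊔ V) ^ n ≤ truncation 𝒜 (n * N) :=
      (pow_le_pow_left' (sup_le (one_le_truncation N) hN) n).trans (truncation_pow_le N n)
    -- Letters have positive degree, so no exponent in a monomial of degree at most `n * N` exceeds
    -- that bound.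
    let v : (S → Fin (n * N + 1)) → A := fun f => orderedMonomial x (∑ s, (f s : ℕ) • {s})
    have h2 : truncation 𝒜 (n * N) ≤ Submodule.span k (Set.range v) := by
      refine Submodule.span_le.2 ?_
      rintro a ⟨i, hi, ha⟩
      refine Submodule.span_mono ?_ (hspan i ha)
      rintro _ ⟨α, hα, rfl⟩
      have hc : ∀ s, α.count s < n * N + 1 := by
        intro s
        have h3 := card_le_sum_map hd α
        have h4 := Multiset.count_le_card s α
        have h5 : (α.map d).sum = i := hα
        omega
      refine ⟨fun s => ⟨α.count s, hc s⟩, congrArg (orderedMonomial x) ?_⟩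
      ext s
      simp [Multiset.count_sum', Multiset.count_singleton]
    have := Module.Finite.span_of_finite k (Set.finite_range v)
    refine (Submodule.finrank_mono (h1.trans h2)).trans ((finrank_range_le_card v).trans ?_)
    simp
  rw [← (tendsto_add_div_log (Fintype.card S : ℝ)
    (Fintype.card S * Real.log (N + 1))).limsup_eq]
  refine limsup_le_limsup ?_
  filter_upwards [eventually_ge_atTop 2] with n hn
  rw [EReal.coe_le_coe_iff]
  have hlogn : 0 < Real.log n := Real.log_pos (by exact_mod_cast hn)
  rw [div_le_iff₀ hlogn, add_mul, div_mul_cancel₀ _ hlogn.ne', ← mul_add,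
    ← Real.log_mul (by positivity) (by positivity), ← Real.log_pow]
  have h1 : (Module.finrank k ↥((1 ⊔ V) ^ n) : ℝ) ≤ ((n : ℝ) * (N + 1)) ^ Fintype.card S := by
    have h2 : (Module.finrank k ↥((1 ⊔ V) ^ n) : ℝ) ≤ ((n * N + 1 : ℕ) : ℝ) ^ Fintype.card S := by
      exact_mod_cast hrank n
    refine h2.trans (pow_le_pow_left₀ (by positivity) ?_ _)
    have : (1 : ℝ) ≤ n := by exact_mod_cast (by omega : 1 ≤ n)
    push_cast
    linarith
  -- The algebra may be trivial here; rank zero is covered by the convention `Real.log 0 = 0`.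
  rcases Nat.eq_zero_or_pos (Module.finrank k ↥((1 ⊔ V) ^ n)) with h0 | hpos
  · rw [h0]
    simp only [Nat.cast_zero, Real.log_zero]
    refine Real.log_nonneg (one_le_pow₀ ?_)
    have h3 : (1 : ℝ) ≤ n := by exact_mod_cast (by omega : 1 ≤ n)
    nlinarith [(Nat.cast_nonneg N : (0 : ℝ) ≤ N)]
  · exact Real.log_le_log (by exact_mod_cast hpos) h1

end Growth

end GradedHopf

namespace GradedHopf

/-! ### Linear algebra and recognition of polynomial algebras -/

section LinearAlgebra

variable {k : Type*} [Field k]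

lemma injective_of_linearIndependent_comp {M N ι : Type*} [AddCommGroup M] [Module k M]
    [AddCommGroup N] [Module k N] (f : M →ₗ[k] N) {v : ι → M}
    (hspan : Submodule.span k (Set.range v) = ⊤) (hli : LinearIndependent k (f ∘ v)) :
    Function.Injective f := by
  rw [← LinearMap.ker_eq_bot, Submodule.eq_bot_iff]
  intro u hu
  have hu' : u ∈ Submodule.span k (Set.range v) := by rw [hspan]; trivial
  obtain ⟨c, rfl⟩ := (Finsupp.mem_span_range_iff_exists_finsupp).1 hu'
  have h := linearIndependent_iff.1 hli c (by
    rw [LinearMap.mem_ker, map_finsuppSum] at hu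
    simpa [Finsupp.linearCombination_apply] using hu)
  simp [h]

lemma rank_span_image {M ι : Type*} [AddCommGroup M] [Module k M] {v : ι → M}
    (hli : LinearIndependent k v) {T : Set ι} (hT : T.Finite) :
    Module.rank k (Submodule.span k (v '' T)) = (T.ncard : Cardinal) := by
  have h : LinearIndepOn k id (v '' T) := (hli.linearIndepOn T).id_image
  rw [rank_span_set h, ← Set.cast_ncard (hT.image v), Set.ncard_image_of_injective _ hli.injective]

/-- If the ordered monomials in commuting elements of an algebra form a basis, then the algebra is
a polynomial algebra. -/
lemma nonempty_algEquiv_mvPolynomial {A S : Type*} [Ring A] [Algebra k A] [LinearOrder S]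
    {x : S → A} (hcomm : ∀ a b : A, a * b = b * a)
    (hli : LinearIndependent k (orderedMonomial x))
    (hspan : Submodule.span k (Set.range (orderedMonomial x)) = ⊤) :
    Nonempty (A ≃ₐ[k] MvPolynomial S k) := by
  have hadd : ∀ α β, orderedMonomial x (α + β) = orderedMonomial x α * orderedMonomial x β := by
    intro α β
    have hp : ((α + β).sort (· ≤ ·)).Perm (α.sort (· ≤ ·) ++ β.sort (· ≤ ·)) := by
      rw [← Multiset.coe_eq_coe, ← Multiset.coe_add]
      simp only [Multiset.sort_eq]
    rw [orderedMonomial, orderedMonomial, orderedMonomial, ← List.prod_append, ← List.map_append]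
    exact (hp.map x).prod_eq' (List.pairwise_of_forall fun a b => hcomm a b)
  let B := Module.Basis.mk hli hspan.ge
  let e := (MvPolynomial.basisMonomials S k).equiv B Multiset.toFinsupp.symm.toEquiv
  have he : ∀ c, e (MvPolynomial.basisMonomials S k c) =
      orderedMonomial x (Multiset.toFinsupp.symm c) := by
    intro c
    rw [Module.Basis.equiv_apply, Module.Basis.mk_apply]
    rfl
  -- Multiplicativity of `e` is an identity of bilinear maps, so it suffices on monomials, where
  -- multisets add.
  have hmul : (LinearMap.mul k (MvPolynomial S k)).compr₂ e.toLinearMap =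
      (LinearMap.mul k A).compl₁₂ e.toLinearMap e.toLinearMap := by
    refine (MvPolynomial.basisMonomials S k).ext fun c => (MvPolynomial.basisMonomials S k).ext
      fun c' => ?_
    have hm : MvPolynomial.basisMonomials S k c * MvPolynomial.basisMonomials S k c' =
        MvPolynomial.basisMonomials S k (c + c') := by
      simp [MvPolynomial.coe_basisMonomials, MvPolynomial.monomial_mul]
    simp only [LinearMap.compr₂_apply, LinearMap.compl₁₂_apply, LinearMap.mul_apply',
      LinearEquiv.coe_coe]
    rw [hm, he, he, he, map_add, hadd]
  have hone : e 1 = 1 := by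
    have h := he 0
    rw [map_zero Multiset.toFinsupp.symm, orderedMonomial_zero] at h
    exact h
  exact ⟨(AlgEquiv.ofLinearEquiv e hone fun p q =>
    LinearMap.congr_fun (LinearMap.congr_fun hmul p) q).symm⟩

end LinearAlgebra

/-! ### The spanning half of PBW for enveloping algebras -/

section Enveloping

attribute [local instance] LieRing.ofAssociativeRing

variable {k L S : Type*} [Field k] [LieRing L] [LieAlgebra k L] [LinearOrder S]

/-- The ordered monomials in a basis of a Lie algebra span its universal enveloping algebra. -/
theorem span_orderedMonomial_universalEnveloping (b : Module.Basis S k L) :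
    Submodule.span k (Set.range (orderedMonomial fun s => UniversalEnvelopingAlgebra.ι k (b s))) =
      ⊤ := by
  set y : S → UniversalEnvelopingAlgebra k L := fun s => UniversalEnvelopingAlgebra.ι k (b s)
    with hy
  have hι : ∀ z : L, UniversalEnvelopingAlgebra.ι k z ∈ Submodule.span k (Set.range y) := by
    intro z
    have h := Submodule.mem_map_of_mem
      (f := (UniversalEnvelopingAlgebra.ι k : L →ₗ⁅k⁆ UniversalEnvelopingAlgebra k L).toLinearMap)
      (b.mem_span z)
    rw [Submodule.map_span, ← Set.range_comp] at h
    exact h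
  let N : Subalgebra k (UniversalEnvelopingAlgebra k L) := Algebra.adjoin k (Set.range y)
  have hιN : ∀ z : L, UniversalEnvelopingAlgebra.ι k z ∈ N := fun z =>
    Algebra.span_le_adjoin k _ (hι z)
  let f : L →ₗ⁅k⁆ N :=
    { toFun := fun z => ⟨UniversalEnvelopingAlgebra.ι k z, hιN z⟩
      map_add' := fun a c => Subtype.ext (map_add _ a c)
      map_smul' := fun a c => Subtype.ext (map_smul _ a c)
      map_lie' := fun {a c} => Subtype.ext (LieHom.map_lie _ a c) }
  -- Lifting `ι` into the subalgebra generated by the `y s` and including back is the identity by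
  -- the universal property, so that subalgebra is everything.
  have hid : N.val.comp (UniversalEnvelopingAlgebra.lift k f) = AlgHom.id k _ := by
    apply UniversalEnvelopingAlgebra.hom_ext
    ext z
    simp [f]
  have hN : ∀ u : UniversalEnvelopingAlgebra k L, u ∈ N := by
    intro u
    have h := AlgHom.congr_fun hid u
    rw [AlgHom.id_apply] at h
    rw [← h]
    exact (UniversalEnvelopingAlgebra.lift k f u).2
  have hword : ∀ l : List S, (l.map y).prod ∈ Submodule.span k (Set.range (orderedMonomial y)) := by
    intro l
    -- With zero weights and the zero filtration the sorting argument is exact: commutators are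
    -- combinations of letters without error.
    have h := word_mem_span_orderedMonomial (k := k) (x := y) (d := fun _ => 0) (F := fun _ => ⊥)
      (fun s n z hz => by simp [(Submodule.mem_bot k).1 hz])
      (fun s n z hz => by simp [(Submodule.mem_bot k).1 hz])
      (fun s t => by
        refine Submodule.mem_sup_left ?_
        have e : y s * y t - y t * y s = UniversalEnvelopingAlgebra.ι k ⁅b s, b t⁆ := by
          rw [LieHom.map_lie]; rfl
        rw [e]
        simpa using hι ⁅b s, b t⁆) l
    rw [sup_bot_eq] at h
    exact Submodule.span_mono (Set.image_subset_range _ _) h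
  rw [eq_top_iff]
  intro u _
  have hu : u ∈ Subalgebra.toSubmodule N := hN u
  rw [Algebra.adjoin_eq_span] at hu
  refine Submodule.span_le.2 ?_ hu
  intro z hz
  have hz' : ∃ l : List S, (l.map y).prod = z := by
    induction hz using Submonoid.closure_induction with
    | mem z hz =>
      obtain ⟨s, rfl⟩ := hz
      exact ⟨[s], by simp⟩
    | one => exact ⟨[], by simp⟩
    | mul a c _ _ ha hc =>
      obtain ⟨l, rfl⟩ := ha
      obtain ⟨l', rfl⟩ := hc
      exact ⟨l ++ l', by simp⟩
  obtain ⟨l, rfl⟩ := hz'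
  exact hword l

end Enveloping

/-! ### Algebras generated in degree one: length equals degree -/

section DegreeOne

lemma LieGenerators.gen_notMem_augFiltration {k A : Type*} [Field k] [Ring A] [Algebra k A]
    {𝒜 : ℕ → Submodule k A} {χ : A →ₐ[k] k} {S : Type} (G : LieGenerators 𝒜 χ S) (s : S) :
    G.gen s ∉ augFiltration χ (G.len s + 1) := by
  intro h
  obtain ⟨f, hf, hf1, -⟩ := exists_dual_of_linearIndepOn_mkQ (G.linearIndepOn (G.len s))
    (i := s) rfl
  rw [hf _ h] at hf1
  exact zero_ne_one hf1

variable {k : Type*} {A : Type*} [Field k] [Ring A] [Nontrivial A] [Algebra k A]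
  {𝒜 : ℕ → Submodule k A} [GradedAlgebra 𝒜] {χ : A →ₐ[k] k} {S : Type}

/-- An element of degree `w` is a combination of `w`-fold products from degree one, which lies in
`ker χ`. -/
lemma le_augFiltration_of_isGeneratedInDegreeOne
    (hχ : ∀ a, algebraMap k A (χ a) = GradedAlgebra.proj 𝒜 0 a)
    (hgen : IsGeneratedInDegreeOne 𝒜) (w : ℕ) : 𝒜 w ≤ augFiltration χ w := by
  have hpow : ∀ n, 𝒜 1 ^ n ≤ 𝒜 n := by
    intro n
    induction n with
    | zero => rw [pow_zero, Submodule.one_le]; exact SetLike.GradedOne.one_mem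
    | succ n ih =>
      rw [pow_succ, Submodule.mul_le]
      exact fun a ha b hb => SetLike.mul_mem_graded (ih ha) hb
  have hall : ∀ a : A, a ∈ Submodule.span k {a | ∃ n, a ∈ 𝒜 1 ^ n} := by
    intro a
    have ha : a ∈ Algebra.adjoin k (𝒜 1 : Set A) := by
      rw [show Algebra.adjoin k (𝒜 1 : Set A) = ⊤ from hgen]; trivial
    induction ha using Algebra.adjoin_induction with
    | mem a ha => exact Submodule.subset_span ⟨1, by simpa using ha⟩
    | algebraMap c =>
      exact Submodule.subset_span ⟨0, by rw [pow_zero]; exact Submodule.algebraMap_mem c⟩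
    | add a b _ _ ha hb => exact add_mem ha hb
    | mul a b _ _ ha hb =>
      have h := Submodule.mul_mem_mul ha hb
      rw [Submodule.span_mul_span] at h
      refine Submodule.span_mono ?_ h
      rintro _ ⟨a, ⟨m, ha⟩, b, ⟨n, hb⟩, rfl⟩
      exact ⟨m + n, by rw [pow_add]; exact Submodule.mul_mem_mul ha hb⟩
  intro a ha
  have h1 : 𝒜 1 ^ w ≤ augFiltration χ w := by
    have h2 := pow_le_pow_left' (homogeneous_le_augFiltration_one hχ one_pos : 𝒜 1 ≤ _) w
    rw [augFiltration_one] at h2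
    refine h2.trans fun b hb => ?_
    simpa [augFiltration] using Submodule.mul_mem_mul hb (Submodule.mem_top (x := (1 : A)))
  have h2 : GradedAlgebra.proj 𝒜 w a ∈ 𝒜 1 ^ w := by
    refine (Submodule.span_le.2 ?_ : _ ≤ (𝒜 1 ^ w).comap (GradedAlgebra.proj 𝒜 w)) (hall a)
    rintro b ⟨n, hb⟩
    rw [SetLike.mem_coe, Submodule.mem_comap, proj_of_mem (hpow n hb)]
    split_ifs with h
    · exact h ▸ hb
    · exact zero_mem _
  rw [proj_of_mem ha, if_pos rfl] at h2
  exact h1 h2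

namespace LieGenerators

variable (G : LieGenerators 𝒜 χ S)

/-- The error term in `F (j + 1)` is homogeneous of degree `w ≤ j`, hence zero. -/
lemma lieWords_eq_span (hχ : ∀ a, algebraMap k A (χ a) = GradedAlgebra.proj 𝒜 0 a) {j w : ℕ}
    (hjw : w ≤ j) :
    lieWords 𝒜 j w = Submodule.span k (G.gen '' {s | G.len s = j ∧ G.deg s = w}) := by
  refine le_antisymm (fun a ha => ?_) (Submodule.span_le.2 ?_)
  · obtain ⟨p, hp, q, hq, hpq⟩ := Submodule.mem_sup.1 (G.lieWords_le j w ha)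
    have hp' : p ∈ 𝒜 w := by
      refine Submodule.span_le.2 ?_ hp
      rintro _ ⟨s, hs, rfl⟩
      exact hs.2 ▸ G.gen_mem_homogeneous s
    have hq' : q ∈ 𝒜 w := by
      rw [← add_sub_cancel_left p q, hpq]
      exact sub_mem (GradedHopf.lieWords_le 𝒜 j w ha) hp'
    have hq0 := eq_zero_of_mem_augFiltration hχ hq hq' (by omega)
    rw [← hpq, hq0, add_zero]
    exact hp
  · rintro _ ⟨s, ⟨rfl, rfl⟩, rfl⟩
    exact G.gen_mem s

/-- A generator shorter than its degree would lie in `F (len + 1)`, contradicting independence to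
leading order. -/
lemma len_eq_deg (hχ : ∀ a, algebraMap k A (χ a) = GradedAlgebra.proj 𝒜 0 a)
    (hgen : IsGeneratedInDegreeOne 𝒜) (s : S) : G.len s = G.deg s := by
  refine le_antisymm (G.len_le_deg s) ?_
  by_contra h
  exact G.gen_notMem_augFiltration s (augFiltration_antitone χ (by omega : G.len s + 1 ≤ G.deg s)
    (le_augFiltration_of_isGeneratedInDegreeOne hχ hgen _ (G.gen_mem_homogeneous s)))

lemma lieWords_self_eq_span (hχ : ∀ a, algebraMap k A (χ a) = GradedAlgebra.proj 𝒜 0 a)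
    (hgen : IsGeneratedInDegreeOne 𝒜) (w : ℕ) :
    lieWords 𝒜 w w = Submodule.span k (G.gen '' {s | G.deg s = w}) := by
  rw [G.lieWords_eq_span hχ le_rfl]
  congr 2
  ext s
  simp only [Set.mem_ofPred_eq, G.len_eq_deg hχ hgen, and_self]

lemma span_range_orderedMonomial [LinearOrder S]
    (hχ : ∀ a, algebraMap k A (χ a) = GradedAlgebra.proj 𝒜 0 a) :
    Submodule.span k (Set.range (orderedMonomial G.gen)) = ⊤ := by
  rw [eq_top_iff]
  intro a _
  induction a using DirectSum.Decomposition.inductionOn 𝒜 with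
  | zero => exact zero_mem _
  | @homogeneous i a =>
    exact Submodule.span_mono (Set.image_subset_range _ _) ((G.span_orderedMonomial hχ i).ge a.2)
  | add a b ha hb => exact add_mem (ha trivial) (hb trivial)

end LieGenerators

/-- The inner word of length `j` has degree at most `j`: it vanishes by hypothesis in degree `j` and
for length reasons below. -/
lemma lieWords_self_succ_eq_bot (hχ : ∀ a, algebraMap k A (χ a) = GradedAlgebra.proj 𝒜 0 a)
    {j : ℕ} (hj : 0 < j) (h : lieWords 𝒜 j j = ⊥) : lieWords 𝒜 (j + 1) (j + 1) = ⊥ := by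
  obtain ⟨i, rfl⟩ : ∃ i, j = i + 1 := ⟨j - 1, by omega⟩
  rw [lieWords, eq_bot_iff, Submodule.span_le]
  rintro _ ⟨a, b, ha, hab, x, hx, y, hy, rfl⟩
  have hy0 : y = 0 := by
    rcases lt_or_ge b (i + 1) with hb | hb
    · rw [lieWords_eq_bot_of_lt hχ hb] at hy
      exact (Submodule.mem_bot k).1 hy
    · obtain rfl : b = i + 1 := by omega
      rw [h] at hy
      exact (Submodule.mem_bot k).1 hy
  simp [hy0]

end DegreeOne

end GradedHopf

namespace GradedHopf

/-! ### The graded Lie algebra and its enveloping algebra -/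

section LieAlgebra

attribute [local instance] LieRing.ofAssociativeRing

variable {k : Type u} {A : Type v} [Field k] [Ring A] [Nontrivial A] [Algebra k A]
  {𝒜 : ℕ → Submodule k A} [GradedAlgebra 𝒜] {χ : A →ₐ[k] k} {S : Type}

namespace LieGenerators

variable (G : LieGenerators 𝒜 χ S)

lemma lieWords_self_le_span_range (hχ : ∀ a, algebraMap k A (χ a) = GradedAlgebra.proj 𝒜 0 a)
    (hgen : IsGeneratedInDegreeOne 𝒜) (w : ℕ) :
    lieWords 𝒜 w w ≤ Submodule.span k (Set.range G.gen) := by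
  rw [G.lieWords_self_eq_span hχ hgen]
  exact Submodule.span_mono (Set.image_subset_range _ _)

lemma gen_mem_lieWords_deg (hχ : ∀ a, algebraMap k A (χ a) = GradedAlgebra.proj 𝒜 0 a)
    (hgen : IsGeneratedInDegreeOne 𝒜) (s : S) :
    G.gen s ∈ lieWords 𝒜 (G.deg s) (G.deg s) := by
  have h := G.gen_mem s
  rwa [G.len_eq_deg hχ hgen] at h

/-- The Lie algebra spanned by the generators of an algebra generated in degree one. -/
def lieSubalgebra (hχ : ∀ a, algebraMap k A (χ a) = GradedAlgebra.proj 𝒜 0 a)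
    (hgen : IsGeneratedInDegreeOne 𝒜) : LieSubalgebra k A :=
  { Submodule.span k (Set.range G.gen) with
    lie_mem' := by
      intro x y hx hy
      have hmul : ∀ s t, ⁅G.gen s, G.gen t⁆ ∈ Submodule.span k (Set.range G.gen) := fun s t =>
        G.lieWords_self_le_span_range hχ hgen _ (commutator_mem_lieWords
          (G.gen_mem_lieWords_deg hχ hgen s) (G.gen_mem_lieWords_deg hχ hgen t))
      have hx' : x ∈ Submodule.span k (Set.range G.gen) := hx
      have hy' : y ∈ Submodule.span k (Set.range G.gen) := hy
      clear hx hy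
      change ⁅x, y⁆ ∈ Submodule.span k (Set.range G.gen)
      induction hx', hy' using Submodule.span_induction₂ with
      | mem_mem x y hx hy =>
        obtain ⟨s, rfl⟩ := hx
        obtain ⟨t, rfl⟩ := hy
        exact hmul s t
      | zero_left => simp
      | zero_right => simp
      | add_left x y z _ _ _ h1 h2 => rw [add_lie]; exact add_mem h1 h2
      | add_right x y z _ _ _ h1 h2 => rw [lie_add]; exact add_mem h1 h2
      | smul_left r x y _ _ h => rw [smul_lie]; exact Submodule.smul_mem _ _ h
      | smul_right r x y _ _ h => rw [lie_smul]; exact Submodule.smul_mem _ _ h }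

/-- The map from the enveloping algebra sends ordered monomials in the Lie basis, which span, to
ordered monomials in the generators, which form a basis of `A`; so it is bijective. -/
theorem exists_gradedLieAlgebra [LinearOrder S]
    (hχ : ∀ a, algebraMap k A (χ a) = GradedAlgebra.proj 𝒜 0 a)
    (hgen : IsGeneratedInDegreeOne 𝒜) (hli : LinearIndependent k (orderedMonomial G.gen)) :
    ∃ (𝔤 : Type v) (_ : LieRing 𝔤) (_ : LieAlgebra k 𝔤)
      (L : ℕ → Submodule k 𝔤) (_ : GradedLieAlgebra L),
      L 0 = ⊥ ∧
      LieSubalgebra.lieSpan k 𝔤 (L 1 : Set 𝔤) = ⊤ ∧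
      Nonempty (A ≃ₐ[k] UniversalEnvelopingAlgebra k 𝔤) ∧
      ∀ i : ℕ+, Module.rank k (L i) = ({s | G.deg s = (i : ℕ)}.ncard : Cardinal) := by
  have hligen : LinearIndependent k G.gen := by
    have := hli.comp (fun s : S => ({s} : Multiset S)) (fun s t h => Multiset.singleton_inj.1 h)
    simpa [Function.comp_def] using this
  let 𝔤 := G.lieSubalgebra hχ hgen
  let b : Module.Basis S k 𝔤 := Module.Basis.span hligen
  have hb : ∀ s, (b s : A) = G.gen s := fun s =>
    congrArg Subtype.val (Module.Basis.span_apply hligen s)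
  let L : ℕ → Submodule k 𝔤 := fun i => (lieWords 𝒜 i i).comap 𝔤.toSubmodule.subtype
  have hL : ∀ i, L i = Submodule.span k (b '' {s | G.deg s = i}) := by
    intro i
    apply Submodule.map_injective_of_injective 𝔤.toSubmodule.injective_subtype
    rw [Submodule.map_span, ← Set.image_comp, Submodule.map_comap_eq, Submodule.range_subtype,
      inf_eq_right.2 (show lieWords 𝒜 i i ≤ 𝔤.toSubmodule from
        G.lieWords_self_le_span_range hχ hgen i), G.lieWords_self_eq_span hχ hgen]
    congr 1
    exact Set.image_congr fun s _ => (hb s).symm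
  have hbL : ∀ s, b s ∈ L (G.deg s) := fun s => by
    rw [hL]; exact Submodule.subset_span ⟨s, rfl, rfl⟩
  let dec : 𝔤 →ₗ[k] DirectSum ℕ fun i => L i :=
    b.constr k fun s => DirectSum.lof k ℕ (fun i => L i) (G.deg s) ⟨b s, hbL s⟩
  have hdec : ∀ s, dec (b s) = DirectSum.lof k ℕ (fun i => L i) (G.deg s) ⟨b s, hbL s⟩ :=
    fun s => b.constr_basis k _ s
  have hdecL : ∀ i (x : 𝔤) (hx : x ∈ L i), dec x = DirectSum.lof k ℕ (fun i => L i) i ⟨x, hx⟩ := by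
    intro i x hx
    have hx' := hx
    rw [hL] at hx'
    induction hx' using Submodule.span_induction with
    | mem x h =>
      obtain ⟨s, rfl, rfl⟩ := h
      exact hdec s
    | zero => rw [map_zero]; exact (map_zero _).symm
    | add x y hx' hy' h1 h2 =>
      rw [map_add, h1 (hL i ▸ hx'), h2 (hL i ▸ hy'), ← map_add]
      rfl
    | smul c x hx' h =>
      rw [map_smul, h (hL i ▸ hx'), ← map_smul]
      rfl
  let decomp : DirectSum.Decomposition L := DirectSum.Decomposition.ofLinearMap L dec
    (by
      refine b.ext fun s => ?_
      rw [LinearMap.comp_apply, hdec, DirectSum.coeLinearMap_lof, LinearMap.id_apply])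
    (by
      refine DirectSum.linearMap_ext k fun i => LinearMap.ext fun x => ?_
      rw [LinearMap.comp_apply, LinearMap.comp_apply, DirectSum.coeLinearMap_lof,
        hdecL i x x.2]
      rfl)
  have hbr : SetLike.GradedBracket L := ⟨fun i j x y hx hy => commutator_mem_lieWords hx hy⟩
  refine ⟨𝔤, inferInstance, inferInstance, L, { hbr, decomp with }, ?_, ?_, ?_, ?_⟩
  · rw [eq_bot_iff]
    intro x hx
    have hx' : (x : A) ∈ lieWords 𝒜 0 0 := hx
    rw [lieWords_zero, Submodule.mem_bot] at hx'
    exact Subtype.ext hx'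
  · let N := LieSubalgebra.lieSpan k 𝔤 (L 1 : Set 𝔤)
    have hN : ∀ i, lieWords 𝒜 i i ≤ N.toSubmodule.map (𝔤.incl : 𝔤 →ₗ[k] A) := by
      intro i
      induction i using Nat.strong_induction_on with
      | _ i ih =>
      match i, ih with
      | 0, _ => rw [lieWords_zero]; exact bot_le
      | 1, _ =>
        intro a ha
        exact ⟨⟨a, G.lieWords_self_le_span_range hχ hgen 1 ha⟩, LieSubalgebra.subset_lieSpan ha, rfl⟩
      | i + 2, ih =>
        rw [lieWords, Submodule.span_le]
        rintro _ ⟨p, q, hp, hpq, x, hx, y, hy, rfl⟩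
        rcases lt_or_ge q (i + 1) with hq | hq
        · rw [lieWords_eq_bot_of_lt hχ hq, Submodule.mem_bot] at hy
          simp [hy]
        · obtain rfl : q = i + 1 := by omega
          -- A nonzero Lie word of length equal to its degree uses only factors of degree one, so
          -- degree one generates.
          obtain rfl : p = 1 := by omega
          rw [← lieWords_one 𝒜 one_pos] at hx
          obtain ⟨x', hx', rfl⟩ := ih 1 (by omega) hx
          obtain ⟨y', hy', rfl⟩ := ih (i + 1) (by omega) hy
          exact ⟨⁅x', y'⁆, N.lie_mem hx' hy', rfl⟩
    rw [eq_top_iff]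
    intro x _
    have hx : x ∈ Submodule.span k (Set.range b) := b.mem_span x
    refine (Submodule.span_le.2 ?_ : _ ≤ N.toSubmodule) hx
    rintro _ ⟨s, rfl⟩
    obtain ⟨y, hy, hys⟩ := hN (G.deg s) (hbL s)
    rwa [← Subtype.ext hys]
  · let φ : UniversalEnvelopingAlgebra k 𝔤 →ₐ[k] A := UniversalEnvelopingAlgebra.lift k 𝔤.incl
    have hφ : ∀ α, φ (orderedMonomial (fun s => UniversalEnvelopingAlgebra.ι k (b s)) α) =
        orderedMonomial G.gen α := by
      intro α
      rw [map_orderedMonomial]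
      congr 1
      funext s
      rw [UniversalEnvelopingAlgebra.lift_ι_apply]
      exact hb s
    have hinj : Function.Injective φ := by
      refine injective_of_linearIndependent_comp φ.toLinearMap
        (span_orderedMonomial_universalEnveloping b) ?_
      have e : φ.toLinearMap ∘ orderedMonomial (fun s => UniversalEnvelopingAlgebra.ι k (b s)) =
          orderedMonomial G.gen := funext hφ
      rw [e]
      exact hli
    have hsurj : Function.Surjective φ := by
      have h : Submodule.span k (Set.range (orderedMonomial G.gen)) ≤
          LinearMap.range φ.toLinearMap := by
        refine Submodule.span_le.2 ?_
        rintro _ ⟨α, rfl⟩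
        exact ⟨_, hφ α⟩
      rw [G.span_range_orderedMonomial hχ] at h
      exact fun a => h (Submodule.mem_top (x := a))
    exact ⟨(AlgEquiv.ofBijective φ ⟨hinj, hsurj⟩).symm⟩
  · intro i
    rw [hL]
    exact rank_span_image b.linearIndependent (G.finite_deg i)

end LieGenerators

end LieAlgebra

end GradedHopf

namespace GradedHopf

open PowerSeries
open scoped ENNReal PowerSeries.WithPiTopology

lemma coe_ennreal_natCast (n : ℕ) : ((n : ℝ≥0∞) : EReal) = ((n : ℝ) : EReal) := by
  rw [← ENNReal.coe_natCast]
  rfl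

/-! ### Numerical consequences -/

section Consequences

variable {k : Type u} {A : Type v} [Field k] [Ring A] [Algebra k A]
  {𝒜 : ℕ → Submodule k A} {χ : A →ₐ[k] k} {S : Type}

namespace LieGenerators

variable (G : LieGenerators 𝒜 χ S)

/-- The number of generators of each degree. -/
noncomputable def multiplicity (i : ℕ+) : ℕ := {s | G.deg s = (i : ℕ)}.ncard

lemma multiplicity_eq_zero_iff {i : ℕ+} : G.multiplicity i = 0 ↔ ∀ s, G.deg s ≠ i := by
  rw [multiplicity, Set.ncard_eq_zero (G.finite_deg i), Set.eq_empty_iff_forall_notMem]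
  rfl

theorem tsum_multiplicity_le_GKdim [LinearOrder S]
    (hli : LinearIndependent k (orderedMonomial G.gen)) :
    ((∑' i : ℕ+, (G.multiplicity i : ℝ≥0∞) : ℝ≥0∞) : EReal) ≤ GKdim k A := by
  classical
  -- Nonnegativity, from the empty set of generators, allows the comparison to take place in `ℝ≥0∞`,
  -- where partial sums suffice.
  have h0 : 0 ≤ GKdim k A := by simpa using card_le_GKdim hli ∅
  rw [← EReal.coe_toENNReal h0, EReal.coe_ennreal_le_coe_ennreal_iff]
  refine ENNReal.summable.tsum_le_of_sum_le fun F => ?_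
  have hcard : ∑ i ∈ F, G.multiplicity i =
      (F.biUnion fun i => (G.finite_deg i).toFinset).card := by
    rw [Finset.card_biUnion]
    · exact Finset.sum_congr rfl fun i _ => Set.ncard_eq_toFinset_card _ (G.finite_deg i)
    · intro i _ j _ hij
      rw [Function.onFun, Finset.disjoint_left]
      intro s hi hj
      rw [Set.Finite.mem_toFinset] at hi hj
      exact hij (PNat.coe_injective (hi.symm.trans hj))
  have h := card_le_GKdim hli (F.biUnion fun i => (G.finite_deg i).toFinset)
  rw [← hcard, ← EReal.coe_toENNReal h0] at h
  rw [← EReal.coe_ennreal_le_coe_ennreal_iff]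
  refine le_trans (le_of_eq ?_) h
  rw [← Nat.cast_sum, coe_ennreal_natCast]

variable [Nontrivial A] [GradedAlgebra 𝒜]

theorem isInverseProduct_hilbertSeries [LinearOrder S]
    (hχ : ∀ a, algebraMap k A (χ a) = GradedAlgebra.proj 𝒜 0 a)
    (hli : LinearIndependent k (orderedMonomial G.gen)) :
    IsInverseProduct (hilbertSeries 𝒜) G.multiplicity := by
  have h : hilbertSeries 𝒜 = multisetSeries G.deg Set.univ := by
    ext w
    have e : weightedMultisets G.deg Set.univ w = {α | (α.map G.deg).sum = w} := by
      ext α; simp [weightedMultisets]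
    have hfin := finite_weightedMultisets G.deg_pos G.finite_deg Set.univ w
    rw [e] at hfin
    have hr := rank_span_image hli hfin
    rw [G.span_orderedMonomial hχ] at hr
    rw [hilbertSeries, multisetSeries, coeff_mk, coeff_mk, e, Module.finrank, hr,
      Cardinal.toNat_natCast]
  rw [h]
  exact isInverseProduct_multisetSeries G.deg_pos G.finite_deg

theorem multiplicity_succ_eq_zero (hχ : ∀ a, algebraMap k A (χ a) = GradedAlgebra.proj 𝒜 0 a)
    (hgen : IsGeneratedInDegreeOne 𝒜) {i : ℕ+} (hi : G.multiplicity i = 0) :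
    G.multiplicity (i + 1) = 0 := by
  rw [multiplicity_eq_zero_iff] at hi ⊢
  intro s hs
  have h1 : lieWords 𝒜 i i = ⊥ := by
    rw [G.lieWords_self_eq_span hχ hgen]
    simp [hi]
  have h2 := G.gen_mem_lieWords_deg hχ hgen s
  rw [hs, PNat.add_coe, PNat.one_coe, lieWords_self_succ_eq_bot hχ i.pos h1,
    Submodule.mem_bot] at h2
  exact G.gen_notMem_augFiltration s (h2 ▸ zero_mem _)

theorem multiplicity_one_ne_zero (hχ : ∀ a, algebraMap k A (χ a) = GradedAlgebra.proj 𝒜 0 a)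
    (hgen : IsGeneratedInDegreeOne 𝒜) (hne : (⊥ : Subalgebra k A) ≠ ⊤) :
    G.multiplicity 1 ≠ 0 := by
  intro h
  rw [multiplicity_eq_zero_iff] at h
  have h1 : 𝒜 1 = ⊥ := by
    rw [← lieWords_one 𝒜 one_pos, G.lieWords_self_eq_span hχ hgen]
    have : ∀ s, G.deg s ≠ 1 := h
    simp [this]
  apply hne
  rw [← show Algebra.adjoin k (𝒜 1 : Set A) = ⊤ from hgen, h1]
  symm
  rw [eq_bot_iff, Algebra.adjoin_le_iff]
  rintro a ha
  have : a = 0 := by simpa using ha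
  rw [this]
  exact zero_mem _

theorem exists_setOf_multiplicity_ne_zero
    (hχ : ∀ a, algebraMap k A (χ a) = GradedAlgebra.proj 𝒜 0 a)
    (hgen : IsGeneratedInDegreeOne 𝒜) (hne : (⊥ : Subalgebra k A) ≠ ⊤) :
    ∃ ℓ : ℕ∞, 2 ≤ ℓ ∧ {j : ℕ+ | G.multiplicity j ≠ 0} = {j : ℕ+ | ((j : ℕ) : ℕ∞) < ℓ} := by
  classical
  by_cases hall : ∀ j, G.multiplicity j ≠ 0
  · refine ⟨⊤, le_top, ?_⟩
    ext j
    simp [hall j]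
  · push Not at hall
    -- `ℓ` is the first index with zero multiplicity; it exceeds one, and all later multiplicities
    -- vanish too.
    have hfind := PNat.find_spec hall
    set m := PNat.find hall with hm
    refine ⟨((m : ℕ) : ℕ∞), ?_, ?_⟩
    · have h1 : m ≠ 1 := by
        intro h
        rw [h] at hfind
        exact G.multiplicity_one_ne_zero hχ hgen hne hfind
      have h2 : (1 : ℕ) < m := by
        exact_mod_cast lt_of_le_of_ne one_le h1.symm
      exact_mod_cast h2
    · ext j
      simp only [Set.mem_ofPred_eq, Nat.cast_lt, PNat.coe_lt_coe]
      constructor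
      · intro hj
        by_contra hlt
        apply hj
        have hle : m ≤ j := not_lt.1 hlt
        clear hj hlt
        induction j using PNat.recOn with
        | one =>
          rw [← le_antisymm hle one_le]
          exact hfind
        | succ j ih =>
          rcases hle.eq_or_lt with h | h
          · rw [← h]; exact hfind
          · exact G.multiplicity_succ_eq_zero hχ hgen (ih (PNat.lt_add_one_iff.1 h))
      · intro hj h0
        exact PNat.find_min hall hj h0

theorem nonempty_algEquiv_mvPolynomial_of_hilbertSeries [LinearOrder S]
    (hχ : ∀ a, algebraMap k A (χ a) = GradedAlgebra.proj 𝒜 0 a)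
    (hli : LinearIndependent k (orderedMonomial G.gen)) {d : ℕ}
    (hd : hilbertSeries 𝒜 * (1 - (X : ℤ⟦X⟧)) ^ d = 1) :
    (∀ a b : A, a * b = b * a) ∧ Nonempty (A ≃ₐ[k] MvPolynomial (Fin d) k) := by
  classical
  -- The series is also the inverse product with exponent `d` at index one only; uniqueness of
  -- exponents puts all generators in degree one.
  have hmult : (fun i : ℕ+ => if i = 1 then d else 0) = G.multiplicity := by
    refine IsInverseProduct.unique ⟨(1 - X) ^ d, ?_, hd⟩ (G.isInverseProduct_hilbertSeries hχ hli)
    have h := hasProd_single (f := fun i : ℕ+ => (1 - (X : ℤ⟦X⟧) ^ (i : ℕ)) ^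
      (if i = 1 then d else 0)) 1 (fun i hi => by simp [hi])
    simpa using h
  have hdeg : ∀ s, G.deg s = 1 := by
    intro s
    by_contra hs
    obtain ⟨i, hi⟩ : ∃ i : ℕ+, (i : ℕ) = G.deg s := ⟨⟨_, G.deg_pos s⟩, rfl⟩
    have h1 : G.multiplicity i = 0 := by
      rw [← hmult]
      exact if_neg fun h => hs (by rw [← hi, h, PNat.one_coe])
    exact G.multiplicity_eq_zero_iff.1 h1 s hi.symm
  have hfinS : Finite S := by
    have h := G.finite_deg 1
    rw [show {s | G.deg s = 1} = Set.univ from Set.eq_univ_of_forall hdeg] at h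
    exact Set.finite_univ_iff.1 h
  have hcard : Nat.card S = d := by
    have h : d = G.multiplicity 1 := by rw [← hmult]; simp
    rw [h, multiplicity]
    rw [show {s | G.deg s = ((1 : ℕ+) : ℕ)} = Set.univ from Set.eq_univ_of_forall hdeg,
      Set.ncard_univ]
  have hcomm : ∀ s t, G.gen s * G.gen t = G.gen t * G.gen s := by
    intro s t
    have hlen : ∀ s, G.len s = 1 := fun s => by
      have h1 := G.len_pos s
      have h2 := G.len_le_deg s
      rw [hdeg] at h2
      omega
    -- The commutator is a Lie word of length and degree two, exactly a combination of generators of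
    -- length two, of which there are none.
    have h := commutator_mem_lieWords (G.gen_mem s) (G.gen_mem t)
    rw [hlen, hlen, hdeg, hdeg, G.lieWords_eq_span hχ le_rfl] at h
    rw [show {s | G.len s = 1 + 1 ∧ G.deg s = 1 + 1} = ∅ from
      Set.eq_empty_of_forall_notMem fun s hs => by have := hs.1; rw [hlen] at this; omega,
      Set.image_empty, Submodule.span_empty, Submodule.mem_bot] at h
    exact sub_eq_zero.1 h
  have hadj : ∀ a, a ∈ Algebra.adjoin k (Set.range G.gen) := by
    intro a
    have h1 : Submodule.span k (Set.range (orderedMonomial G.gen)) ≤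
        Subalgebra.toSubmodule (Algebra.adjoin k (Set.range G.gen)) := by
      refine Submodule.span_le.2 ?_
      rintro _ ⟨α, rfl⟩
      refine Subalgebra.list_prod_mem _ fun y hy => ?_
      obtain ⟨s, _, rfl⟩ := List.mem_map.1 hy
      exact Algebra.subset_adjoin ⟨s, rfl⟩
    rw [G.span_range_orderedMonomial hχ] at h1
    exact h1 (Submodule.mem_top (x := a))
  have hcommA : ∀ a b : A, a * b = b * a := by
    intro a b
    refine (Algebra.commute_of_mem_adjoin_of_forall_mem_commute (hadj b) ?_ : Commute a b)
    rintro _ ⟨s, rfl⟩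
    refine (Algebra.commute_of_mem_adjoin_of_forall_mem_commute (hadj a) ?_ :
      Commute (G.gen s) a).symm
    rintro _ ⟨t, rfl⟩
    exact hcomm s t
  refine ⟨hcommA, ?_⟩
  obtain ⟨e⟩ := nonempty_algEquiv_mvPolynomial hcommA hli (G.span_range_orderedMonomial hχ)
  exact ⟨e.trans (MvPolynomial.renameEquiv k (Finite.equivFinOfCardEq hcard))⟩

theorem exists_GKdim_le_of_tsum_multiplicity_lt_top [LinearOrder S]
    (hχ : ∀ a, algebraMap k A (χ a) = GradedAlgebra.proj 𝒜 0 a)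
    (hsum : ∑' i : ℕ+, (G.multiplicity i : ℝ≥0∞) < ⊤) :
    ∃ d : ℕ, GKdim k A ≤ (d : ℝ) ∧ (d : ℝ≥0∞) ≤ ∑' i : ℕ+, (G.multiplicity i : ℝ≥0∞) := by
  classical
  -- Nonzero multiplicities are at least one, so a finite sum has only finitely many of them and `S`
  -- is finite.
  have hF := ENNReal.finite_const_le_of_tsum_ne_top hsum.ne one_ne_zero
  have hcover : ∀ s : S, s ∈ hF.toFinset.biUnion fun i => (G.finite_deg i).toFinset := by
    intro s
    obtain ⟨i, hi⟩ : ∃ i : ℕ+, (i : ℕ) = G.deg s := ⟨⟨_, G.deg_pos s⟩, rfl⟩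
    refine Finset.mem_biUnion.2 ⟨i, ?_, by simp [hi]⟩
    rw [Set.Finite.mem_toFinset]
    have h : G.multiplicity i ≠ 0 := fun h => G.multiplicity_eq_zero_iff.1 h s hi.symm
    rw [Set.mem_ofPred_eq]
    exact_mod_cast Nat.one_le_iff_ne_zero.2 h
  let inst : Fintype S := ⟨_, hcover⟩
  refine ⟨Fintype.card S, GKdim_le_card G.deg_pos fun w => (G.span_orderedMonomial hχ w).ge, ?_⟩
  have h1 : Fintype.card S ≤ ∑ i ∈ hF.toFinset, G.multiplicity i := by
    refine Finset.card_biUnion_le.trans (Finset.sum_le_sum fun i _ => ?_)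
    rw [multiplicity, Set.ncard_eq_toFinset_card _ (G.finite_deg i)]
  calc (Fintype.card S : ℝ≥0∞) ≤ ∑ i ∈ hF.toFinset, (G.multiplicity i : ℝ≥0∞) := by
        exact_mod_cast h1
    _ ≤ _ := ENNReal.sum_le_tsum _

end LieGenerators

end Consequences

end GradedHopf
-- Assembly of the theorem
open GradedHopf PowerSeries in
open scoped ENNReal in
theorem theorem2p4 {k : Type u} {H : Type v} [Field k] [IsAlgClosed k] [CharZero k]
    [Ring H] [HopfAlgebra k H] (𝒜 : ℕ → Submodule k H) [GradedAlgebra 𝒜]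
    (hconn : IsConnected 𝒜) (hfin : IsLocallyFinite 𝒜) :
    ∃ n : ℕ+ → ℕ,
      -- (1)
      (IsInverseProduct (hilbertSeries 𝒜) n ∧
        ∀ m : ℕ+ → ℕ, IsInverseProduct (hilbertSeries 𝒜) m → m = n) ∧
      -- (2)
      (IsGeneratedInDegreeOne 𝒜 →
        ∃ (𝔤 : Type v) (_ : LieRing 𝔤) (_ : LieAlgebra k 𝔤)
          (L : ℕ → Submodule k 𝔤) (_ : GradedLieAlgebra L),
          L 0 = ⊥ ∧
          LieSubalgebra.lieSpan k 𝔤 (L 1 : Set 𝔤) = ⊤ ∧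
          Nonempty (H ≃ₐ[k] UniversalEnvelopingAlgebra k 𝔤) ∧
          ∀ i : ℕ+, Module.rank k (L i) = (n i : Cardinal)) ∧
      -- (3)
      (IsGeneratedInDegreeOne 𝒜 → (⊥ : Subalgebra k H) ≠ ⊤ →
        ∃ ℓ : ℕ∞, 2 ≤ ℓ ∧ {j : ℕ+ | n j ≠ 0} = {j : ℕ+ | ((j : ℕ) : ℕ∞) < ℓ}) ∧
      -- (4)
      (∀ d : ℕ, hilbertSeries 𝒜 * (1 - (X : ℤ⟦X⟧)) ^ d = 1 →
        (∀ a b : H, a * b = b * a) ∧ Nonempty (H ≃ₐ[k] MvPolynomial (Fin d) k)) ∧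
      -- (5)
      ((GKdim k H < ⊤ ↔ ∑' i : ℕ+, (n i : ℝ≥0∞) < ⊤) ∧
        (GKdim k H < ⊤ → GKdim k H = ((∑' i : ℕ+, (n i : ℝ≥0∞) : ℝ≥0∞) : EReal))) := by
  classical
  have : Nontrivial H := (Bialgebra.counitAlgHom k H).toRingHom.domain_nontrivial
  obtain ⟨χ, hχ⟩ := exists_augmentation 𝒜 hconn
  obtain ⟨D, hDl, hDr⟩ := exists_comul_with_counit χ
  obtain ⟨S, ⟨G⟩⟩ := exists_lieGenerators 𝒜 hfin hχ
  -- Any linear order will do: it only fixes how monomials are sorted.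
  let inst : LinearOrder S := linearOrderOfSTO WellOrderingRel
  have hli := G.linearIndependent_orderedMonomial hχ
    fun a ha => comul_sub_mem_of_counit hDl hDr ha
  have h1 := G.isInverseProduct_hilbertSeries hχ hli
  have hlow := G.tsum_multiplicity_le_GKdim hli
  have hup : ∑' i : ℕ+, (G.multiplicity i : ℝ≥0∞) < ⊤ →
      GKdim k H ≤ ((∑' i : ℕ+, (G.multiplicity i : ℝ≥0∞) : ℝ≥0∞) : EReal) := by
    intro h
    obtain ⟨d, hd, hd'⟩ := G.exists_GKdim_le_of_tsum_multiplicity_lt_top hχ h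
    refine hd.trans ?_
    refine le_trans (le_of_eq ?_) (EReal.coe_ennreal_le_coe_ennreal_iff.2 hd')
    rw [coe_ennreal_natCast]
  have hiff : GKdim k H < ⊤ ↔ ∑' i : ℕ+, (G.multiplicity i : ℝ≥0∞) < ⊤ := by
    refine ⟨fun h => ?_, fun h => (hup h).trans_lt ?_⟩
    · exact EReal.coe_ennreal_lt_coe_ennreal_iff.1 (hlow.trans_lt h)
    · exact EReal.coe_ennreal_lt_coe_ennreal_iff.2 h
  exact ⟨G.multiplicity, ⟨h1, fun m hm => hm.unique h1⟩,
    fun hgen => G.exists_gradedLieAlgebra hχ hgen hli,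
    fun hgen hne => G.exists_setOf_multiplicity_ne_zero hχ hgen hne,
    fun d hd => G.nonempty_algEquiv_mvPolynomial_of_hilbertSeries hχ hli hd,
    hiff, fun h => le_antisymm (hup (hiff.1 h)) hlow⟩
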